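/- Let $k$ be an algebraically closed field of prime characteristic $p$, let $\delta\ge 2$ be an integer, and let $R=k[x^\delta,x^{\delta-1}y,\dots,y^\delta]\subseteq k[x,y]$ be the homogeneous coordinate ring of the rational normal curve of degree $\delta$, with homogeneous maximal ideal $\mathfrak m$ (the elements of $R$ with zero constant term). For a Noetherian ring $A$ of characteristic $p$ whose Frobenius map is finite, with a maximal ideal $\mathfrak n$ (either $A$ is local, or $A$ is standard graded over a field and $\mathfrak n$ is its homogeneous maximal ideal), put $d=\dim A$, $\kappa=A/\mathfrak n$ and $[\kappa:\kappa^p]=p^\alpha$, and for $e\ge 0$ let ${}^e\!A$ be $A$ regarded as an $A$-module through the $e$-fold iterated Frobenius map, $\mathfrak n^{[p^e]}$ the ideal generated by all $r^{p^e}$ with $r\in\mathfrak n$, $a_e$ the largest rank of a free direct summand of ${}^e\!A$, $\lambda$ the length of an $A$-module, and $\beta_i({}^e\!A)=\dim_\kappa \operatorname{Tor}_i^A({}^e\!A,\kappa)$. The $F$-signature, the Hilbert-Kunz multiplicity and the $i$-th Frobenius Betti number of $A$ are $$s(A)=\lim_{e\to\infty}\frac{a_e}{p^{(\alpha+d)e}},\qquad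 e_{HK}(A)=\lim_{e\to\infty}\frac{\lambda(A/\mathfrak n^{[p^e]})}{p^{de}},\qquad \beta_i^F(A)=\lim_{e\to\infty}\frac{\beta_i({}^e\!A)}{p^{(\alpha+d)e}}.$$ Then, both for $A=R$ with $\mathfrak n=\mathfrak m$ and for the local ring $A=R_{\mathfrak m}$ with its maximal ideal, the Frobenius map of $A$ is finite, these limits exist, and $$s(A)=\frac1\delta,\qquad e_{HK}(A)=\frac{\delta+1}{2},\qquad \beta_i^F(A)=\frac{\delta(\delta-1)^i}{2}\quad\text{for all } i\ge 1.$$ -/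

import Mathlib

open Filter Topology CategoryTheory

universe u

noncomputable section

namespace FrobeniusBetti

/-! ### Invariants of a ring of characteristic `p` with a distinguished maximal ideal

`(A, m)` is either a Noetherian local ring with its maximal ideal, or a standard graded algebra over
a field with its homogeneous maximal ideal. -/

/-- The `A`-module `ᵉA`: the ring `A` viewed as an `A`-module through the `e`-fold iterated
Frobenius, so that `r • x = r ^ (p ^ e) * x`. -/
def FrobPush (A : Type u) [CommRing A] (p : ℕ) [Fact p.Prime] [CharP A p] (_e : ℕ) : Type u := A

instance (A : Type u) [CommRing A] (p : ℕ) [Fact p.Prime] [CharP A p] (e : ℕ) :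
    AddCommGroup (FrobPush A p e) :=
  inferInstanceAs (AddCommGroup A)

instance (A : Type u) [CommRing A] (p : ℕ) [Fact p.Prime] [CharP A p] (e : ℕ) :
    Module A (FrobPush A p e) :=
  Module.compHom A (iterateFrobenius A p e)

theorem FrobPush.smul_def (A : Type u) [CommRing A] (p : ℕ) [Fact p.Prime] [CharP A p] (e : ℕ)
    (r : A) (x : FrobPush A p e) : r • x = (r ^ p ^ e * (show A from x) : A) := rfl

/-- The Frobenius power `I^[p^e]`, the ideal generated by all `r ^ (p ^ e)` with `r ∈ I`. -/
def frobPower {A : Type u} [CommRing A] (p : ℕ) (I : Ideal A) (e : ℕ) : Ideal A :=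
  Ideal.span ((fun r : A => r ^ p ^ e) '' (I : Set A))

theorem charP_quotient (A : Type u) [CommRing A] (p : ℕ) [Fact p.Prime] [CharP A p]
    (m : Ideal A) [m.IsMaximal] : CharP (A ⧸ m) p := by
  have h : ((p : ℕ) : A ⧸ m) = 0 := by
    rw [← map_natCast (Ideal.Quotient.mk m) p, CharP.cast_eq_zero, map_zero]
  have : Nontrivial (A ⧸ m) := Ideal.Quotient.nontrivial_iff.2 (Ideal.IsMaximal.ne_top ‹_›)
  exact (CharP.charP_iff_prime_eq_zero Fact.out).2 h

/-- The degree `[κ : κ^p]` of the residue field `κ = A / m` over its subfield of `p`-th powers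
(this is `p ^ α` in the usual normalization of the invariants below). -/
def residueDegree (p : ℕ) [Fact p.Prime] (A : Type u) [CommRing A] [CharP A p]
    (m : Ideal A) [m.IsMaximal] : ℕ :=
  letI : Field (A ⧸ m) := Ideal.Quotient.field m
  haveI : CharP (A ⧸ m) p := charP_quotient A p m
  Module.finrank (frobenius (A ⧸ m) p).fieldRange (A ⧸ m)

/-- `M` has a direct sum decomposition in which a free module of rank `n` is a summand. -/
def HasFreeSummand (A : Type u) [CommRing A] (M : Type u) [AddCommGroup M] [Module A M] (n : ℕ) :
    Prop :=
  ∃ P Q : Submodule A M, IsCompl P Q ∧ Nonempty (P ≃ₗ[A] (Fin n → A))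

/-- `s(A) = c`: for every `e` there is a largest rank `a e` of a free direct summand of `ᵉA`, and
`a e / p ^ ((α + d) e)` converges to `c`, where `d = dim A` and `p ^ α = [κ : κ^p]`. -/
def HasFSignature (p : ℕ) [Fact p.Prime] (A : Type u) [CommRing A] [CharP A p]
    (m : Ideal A) [m.IsMaximal] (c : ℝ) : Prop :=
  (frobenius A p).Finite ∧
  ∃ (d : ℕ) (a : ℕ → ℕ), ringKrullDim A = d ∧
    (∀ e, IsGreatest {n | HasFreeSummand A (FrobPush A p e) n} (a e)) ∧
    Tendsto (fun e : ℕ => (a e : ℝ) / ((residueDegree p A m : ℝ) ^ e * (p : ℝ) ^ (d * e)))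
      atTop (𝓝 c)

/-- `e_HK(A) = c`: the lengths of the `A / m^[p^e]` are finite, and divided by `p ^ (d e)`, with
`d = dim A`, they converge to `c`. -/
def HasHilbertKunzMultiplicity (p : ℕ) (A : Type u) [CommRing A] (m : Ideal A) (c : ℝ) : Prop :=
  ∃ (d : ℕ) (b : ℕ → ℕ), ringKrullDim A = d ∧
    (∀ e, Module.length A (A ⧸ frobPower p m e) = (b e : ℕ∞)) ∧
    Tendsto (fun e : ℕ => (b e : ℝ) / (p : ℝ) ^ (d * e)) atTop (𝓝 c)

/-- The `i`-th Betti number `dim_κ Tor_i(M, κ)` of `M`, with `κ = A / m`. As `Tor_i(M, κ)` is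
annihilated by `m`, its dimension over `κ` is its length as an `A`-module. -/
def betti (A : Type u) [CommRing A] (m : Ideal A) (i : ℕ) (M : Type u) [AddCommGroup M]
    [Module A M] : ℕ∞ :=
  Module.length A
    (((Tor' (ModuleCat.{u} A) i).obj (ModuleCat.of A M)).obj (ModuleCat.of A (A ⧸ m)))

/-- `β_i^F(A) = c`: the Betti numbers `β_i(ᵉA)` are finite, and divided by `p ^ ((α + d) e)`,
where `d = dim A` and `p ^ α = [κ : κ^p]`, they converge to `c`. -/
def HasFrobeniusBetti (p : ℕ) [Fact p.Prime] (A : Type u) [CommRing A] [CharP A p]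
    (m : Ideal A) [m.IsMaximal] (i : ℕ) (c : ℝ) : Prop :=
  (frobenius A p).Finite ∧
  ∃ (d : ℕ) (b : ℕ → ℕ), ringKrullDim A = d ∧
    (∀ e, betti A m i (FrobPush A p e) = (b e : ℕ∞)) ∧
    Tendsto (fun e : ℕ => (b e : ℝ) / ((residueDegree p A m : ℝ) ^ e * (p : ℝ) ^ (d * e)))
      atTop (𝓝 c)

/-! ### The coordinate ring of the rational normal curve -/

/-- The `k`-algebra `k[x^δ, x^(δ-1) y, …, y^δ] ⊆ k[x, y]`. -/
def ratNormalCurve (k : Type u) [Field k] (δ : ℕ) : Subalgebra k (MvPolynomial (Fin 2) k) :=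
  Algebra.adjoin k
    {f | ∃ a b : ℕ, a + b = δ ∧ f = MvPolynomial.X 0 ^ a * MvPolynomial.X 1 ^ b}

/-- The homogeneous maximal ideal: the elements with zero constant term. -/
def homMaxIdeal (k : Type u) [Field k] (δ : ℕ) : Ideal (ratNormalCurve k δ) :=
  RingHom.ker ((MvPolynomial.constantCoeff (R := k) (σ := Fin 2)).comp
    (ratNormalCurve k δ).toSubring.subtype)

instance homMaxIdeal_isMaximal (k : Type u) [Field k] (δ : ℕ) : (homMaxIdeal k δ).IsMaximal := by
  refine RingHom.ker_isMaximal_of_surjective _ fun c => ⟨algebraMap k (ratNormalCurve k δ) c, ?_⟩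
  exact MvPolynomial.constantCoeff_C (Fin 2) c

instance ratNormalCurve_charP (k : Type u) [Field k] (δ p : ℕ) [CharP k p] :
    CharP (ratNormalCurve k δ) p :=
  charP_of_injective_algebraMap (algebraMap k (ratNormalCurve k δ)).injective p

/-- The local ring of the rational normal curve's affine cone at its vertex. -/
abbrev ratNormalCurveLocal (k : Type u) [Field k] (δ : ℕ) : Type u :=
  Localization.AtPrime (homMaxIdeal k δ)

instance ratNormalCurveLocal_charP (k : Type u) [Field k] (δ p : ℕ) [CharP k p] :
    CharP (ratNormalCurveLocal k δ) p :=
  charP_of_injective_algebraMap (algebraMap k (ratNormalCurveLocal k δ)).injective p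

open scoped TensorProduct

/-! ### Minimal syzygies and Betti numbers -/

section MinimalSyzygy

variable {A : Type u} [CommRing A]

/-- `K` is the syzygy module of `M` for a cover of `M` by the free module `A^ι` which is minimal
with respect to the ideal `m`. -/
def IsMinimalSyzygy (m : Ideal A) (ι : Type) (K M : Type u) [AddCommGroup K] [Module A K]
    [AddCommGroup M] [Module A M] : Prop :=
  ∃ (f : K →ₗ[A] ι → A) (g : (ι → A) →ₗ[A] M), Function.Injective f ∧ Function.Exact f g ∧
    Function.Surjective g ∧ ∀ x i, f x i ∈ m

/-- The complex of free modules obtained by splicing short exact sequences. -/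
def splicedComplex (ι : ℕ → Type) (K : ℕ → Type u) [∀ n, AddCommGroup (K n)]
    [∀ n, Module A (K n)] (f : ∀ n, K (n + 1) →ₗ[A] ι n → A) (g : ∀ n, (ι n → A) →ₗ[A] K n)
    (h : ∀ n, Function.Exact (f n) (g n)) : ChainComplex (ModuleCat.{u} A) ℕ :=
  ChainComplex.of (fun n => ModuleCat.of A (ι n → A))
    (fun n => ModuleCat.ofHom ((f n).comp (g (n + 1))))
    (fun n => by
      ext x : 2
      simp [(h (n + 1)).apply_apply_eq_zero])

theorem splicedComplex_d (ι : ℕ → Type) (K : ℕ → Type u) [∀ n, AddCommGroup (K n)]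
    [∀ n, Module A (K n)] (f : ∀ n, K (n + 1) →ₗ[A] ι n → A) (g : ∀ n, (ι n → A) →ₗ[A] K n)
    (h : ∀ n, Function.Exact (f n) (g n)) (n : ℕ) :
    (splicedComplex ι K f g h).d (n + 1) n = ModuleCat.ofHom ((f n).comp (g (n + 1))) :=
  ChainComplex.of_d (fun n => ModuleCat.of A (ι n → A))
    (fun n => ModuleCat.ofHom ((f n).comp (g (n + 1)))) n

/-- The complex obtained by splicing short exact sequences resolves the first module. -/
def splicedResolution (ι : ℕ → Type) [∀ n, Fintype (ι n)] (K : ℕ → Type u)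
    [∀ n, AddCommGroup (K n)]
    [∀ n, Module A (K n)] (f : ∀ n, K (n + 1) →ₗ[A] ι n → A) (g : ∀ n, (ι n → A) →ₗ[A] K n)
    (hf : ∀ n, Function.Injective (f n)) (h : ∀ n, Function.Exact (f n) (g n))
    (hg : ∀ n, Function.Surjective (g n)) :
    ProjectiveResolution (ModuleCat.of A (K 0)) where
  complex := splicedComplex ι K f g h
  projective n := (IsProjective.iff_projective (ι n → A)).1 inferInstance
  π := ((splicedComplex ι K f g h).toSingle₀Equiv _).symm ⟨ModuleCat.ofHom (g 0), by
    rw [splicedComplex_d]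
    exact ModuleCat.hom_ext (LinearMap.ext fun x => (h 0).apply_apply_eq_zero _)⟩
  quasiIso := ⟨fun m => by
    induction m with
    | zero =>
      rw [ChainComplex.quasiIsoAt₀_iff, ShortComplex.quasiIso_iff_of_zeros' _ rfl rfl rfl]
      constructor
      · rw [ShortComplex.moduleCat_exact_iff]
        intro x hx
        obtain ⟨y, hy⟩ := (h 0 x).1 hx
        obtain ⟨z, rfl⟩ := hg 1 y
        refine ⟨z, ?_⟩
        change ((splicedComplex ι K f g h).d 1 0).hom z = x
        rw [splicedComplex_d]
        exact hy
      · rw [ModuleCat.epi_iff_surjective]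
        exact hg 0
    | succ m _ =>
      rw [quasiIsoAt_iff_exactAt' (hL := ChainComplex.exactAt_succ_single_obj ..),
          HomologicalComplex.exactAt_iff' _ (m + 2) (m + 1) m (by simp) (by simp)]
      rw [ShortComplex.moduleCat_exact_iff]
      intro x hx
      change ((splicedComplex ι K f g h).d (m + 1) m).hom x = 0 at hx
      rw [splicedComplex_d] at hx
      have hx' : g (m + 1) x = 0 := hf m (hx.trans (map_zero _).symm)
      obtain ⟨y, hy⟩ := (h (m + 1) x).1 hx'
      obtain ⟨z, rfl⟩ := hg (m + 2) y
      refine ⟨z, ?_⟩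
      change ((splicedComplex ι K f g h).d (m + 1 + 1) (m + 1)).hom z = x
      rw [splicedComplex_d]
      exact hy⟩

theorem isSimpleModule_quotient_of_isMaximal (m : Ideal A) [m.IsMaximal] :
    IsSimpleModule A (A ⧸ m) :=
  isSimpleModule_iff_isCoatom.2 (Ideal.IsMaximal.out)

theorem length_pi_quotient (m : Ideal A) [m.IsMaximal] (ι : Type) [Fintype ι] :
    Module.length A (ι → A ⧸ m) = Fintype.card ι := by
  have := isSimpleModule_quotient_of_isMaximal m
  simp

theorem rTensor_quotient_eq_zero {m : Ideal A} {ι : Type} [Fintype ι] {M : Type u}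
    [AddCommGroup M] [Module A M] (f : M →ₗ[A] ι → A) (hf : ∀ x i, f x i ∈ m) :
    f.rTensor (A ⧸ m) = 0 := by
  classical
  refine TensorProduct.ext' fun x y => ?_
  have h : f x = ∑ i, f x i • (Pi.single i 1 : ι → A) := by
    ext j
    simp [Finset.sum_apply, Pi.single_apply]
  obtain ⟨y, rfl⟩ := Ideal.Quotient.mk_surjective y
  rw [LinearMap.rTensor_tmul, h, TensorProduct.sum_tmul, LinearMap.zero_apply]
  refine Finset.sum_eq_zero fun i _ => ?_
  rw [TensorProduct.smul_tmul, ← Ideal.Quotient.mk_eq_mk, ← Submodule.Quotient.mk_smul,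
    smul_eq_mul, (Submodule.Quotient.mk_eq_zero m).2 (Ideal.mul_mem_right _ _ (hf x i)),
    TensorProduct.tmul_zero]

theorem betti_eq_card {m : Ideal A} [m.IsMaximal] (ι : ℕ → Type) [∀ n, Fintype (ι n)]
    (K : ℕ → Type u) [∀ n, AddCommGroup (K n)] [∀ n, Module A (K n)]
    (h : ∀ n, IsMinimalSyzygy m (ι n) (K (n + 1)) (K n)) (i : ℕ) :
    betti A m i (K 0) = Fintype.card (ι i) := by
  classical
  choose f g hf hfg hg hm using h
  let F := (MonoidalCategory.tensoringRight (ModuleCat.{u} A)).obj (ModuleCat.of A (A ⧸ m))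
  let P := splicedResolution ι K f g hf hfg hg
  have hd : ∀ a b, ((F.mapHomologicalComplex _).obj P.complex).d a b = 0 := by
    intro a b
    by_cases hab : b + 1 = a
    · subst hab
      change F.map ((splicedComplex ι K f g hfg).d (b + 1) b) = 0
      rw [splicedComplex_d]
      exact congrArg ModuleCat.ofHom
        (rTensor_quotient_eq_zero ((f b).comp (g (b + 1))) fun x i => hm b _ i)
    · exact HomologicalComplex.shape _ _ _ hab
  let e := P.isoLeftDerivedObj F i ≪≫ (ShortComplex.HomologyData.ofZeros
    (((F.mapHomologicalComplex _).obj P.complex).sc i) (hd _ _) (hd _ _)).left.homologyIso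
  have e' : TensorProduct A (ι i → A) (A ⧸ m) ≃ₗ[A] (ι i → A ⧸ m) :=
    TensorProduct.comm A _ _ ≪≫ₗ TensorProduct.piScalarRight A A (A ⧸ m) (ι i)
  have : betti A m i (K 0) = Module.length A (TensorProduct A (ι i → A) (A ⧸ m)) :=
    e.toLinearEquiv.length_eq
  rw [this, e'.length_eq, length_pi_quotient]

/-! ### Operations on minimal syzygies -/

variable {m : Ideal A} {ι : Type} {K M K' M' : Type u} [AddCommGroup K] [Module A K]
  [AddCommGroup M] [Module A M] [AddCommGroup K'] [Module A K'] [AddCommGroup M'] [Module A M']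

theorem IsMinimalSyzygy.congr (h : IsMinimalSyzygy m ι K M) (e : K' ≃ₗ[A] K) (e' : M ≃ₗ[A] M') :
    IsMinimalSyzygy m ι K' M' := by
  obtain ⟨f, g, hf, hfg, hg, hm⟩ := h
  refine ⟨f.comp e.toLinearMap, e'.toLinearMap.comp g, hf.comp e.injective, ?_,
    e'.surjective.comp hg, fun x i => hm _ i⟩
  intro x
  simp only [LinearMap.comp_apply, LinearEquiv.coe_coe, map_eq_zero_iff _ e'.injective, hfg x,
    Set.mem_range]
  exact ⟨fun ⟨y, hy⟩ => ⟨e.symm y, by simpa using hy⟩, fun ⟨y, hy⟩ => ⟨e y, hy⟩⟩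

theorem IsMinimalSyzygy.pi {T : Type} {ι : T → Type} {K M : T → Type u}
    [∀ t, AddCommGroup (K t)] [∀ t, Module A (K t)] [∀ t, AddCommGroup (M t)]
    [∀ t, Module A (M t)] (h : ∀ t, IsMinimalSyzygy m (ι t) (K t) (M t)) :
    IsMinimalSyzygy m (Σ t, ι t) (∀ t, K t) (∀ t, M t) := by
  choose f g hf hfg hg hm using h
  refine ⟨LinearMap.pi fun s => (LinearMap.proj s.2).comp ((f s.1).comp (LinearMap.proj s.1)),
    LinearMap.pi fun t => (g t).comp (LinearMap.pi fun i => LinearMap.proj ⟨t, i⟩),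
    ?_, ?_, ?_, fun x s => hm s.1 _ s.2⟩
  · intro x y hxy
    funext t
    refine hf t (funext fun i => congrFun hxy ⟨t, i⟩)
  · intro x
    constructor
    · intro hx
      choose y hy using fun t => (hfg t fun i => x ⟨t, i⟩).1 (congrFun hx t)
      exact ⟨y, funext fun s => congrFun (hy s.1) s.2⟩
    · rintro ⟨y, rfl⟩
      exact funext fun t => (hfg t).apply_apply_eq_zero (y t)
  · intro y
    choose x hx using fun t => hg t (y t)
    exact ⟨fun s => x s.1 s.2, funext hx⟩

/-- A module with a minimal cover by `A^ι` has `card ι` minimal generators. -/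
theorem IsMinimalSyzygy.length_quotient [m.IsMaximal] [Fintype ι]
    (h : IsMinimalSyzygy m ι K M) :
    Module.length A (M ⧸ (m • ⊤ : Submodule A M)) = Fintype.card ι := by
  classical
  obtain ⟨f, g, hf, hfg, hg, hm⟩ := h
  let π : (ι → A) →ₗ[A] (ι → A ⧸ m) :=
    LinearMap.pi fun i => (Submodule.mkQ m).comp (LinearMap.proj i)
  have hπ : Function.Surjective π := fun y => by
    choose x hx using fun i => Submodule.mkQ_surjective m (y i)
    exact ⟨x, funext hx⟩
  have hker : LinearMap.ker π = LinearMap.ker ((m • ⊤ : Submodule A M).mkQ.comp g) := by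
    ext x
    rw [LinearMap.mem_ker, LinearMap.mem_ker, LinearMap.comp_apply, Submodule.mkQ_apply,
      Submodule.Quotient.mk_eq_zero]
    have h1 : π x = 0 ↔ ∀ i, x i ∈ m := by
      rw [funext_iff]
      exact forall_congr' fun i => Submodule.Quotient.mk_eq_zero m
    rw [h1]
    constructor
    · intro hx
      have h : x = ∑ i, x i • (Pi.single i 1 : ι → A) := by
        ext j
        simp [Finset.sum_apply, Pi.single_apply]
      rw [h, map_sum]
      refine Submodule.sum_mem _ fun i _ => ?_
      rw [map_smul]
      exact Submodule.smul_mem_smul (hx i) trivial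
    · intro hx
      have : (m • ⊤ : Submodule A M) = (m • ⊤ : Submodule A (ι → A)).map g := by
        rw [Submodule.map_smul'', Submodule.map_top, LinearMap.range_eq_top.2 hg]
      rw [this] at hx
      obtain ⟨y, hy, hyx⟩ := hx
      have hy' : ∀ i, y i ∈ m := by
        intro i
        have : (m • ⊤ : Submodule A (ι → A)) ≤ Submodule.comap (LinearMap.proj i) m :=
          Submodule.smul_le.2 fun r hr z _ => Ideal.mul_mem_right _ _ hr
        exact this hy
      obtain ⟨z, hz⟩ := (hfg (x - y)).1 (by rw [map_sub, hyx, sub_self])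
      intro i
      have := hm z i
      rw [hz] at this
      simpa using add_mem this (hy' i)
  rw [← length_pi_quotient m ι]
  exact (((LinearMap.quotKerEquivOfSurjective π hπ).symm ≪≫ₗ Submodule.quotEquivOfEq _ _ hker ≪≫ₗ
    LinearMap.quotKerEquivOfSurjective _ ((Submodule.mkQ_surjective _).comp hg)).length_eq).symm

theorem IsMinimalSyzygy.finite [Fintype ι] (h : IsMinimalSyzygy m ι K M) : Module.Finite A M := by
  obtain ⟨f, g, hf, hfg, hg, hm⟩ := h
  exact Module.Finite.of_surjective g hg

theorem IsMinimalSyzygy.baseChange [Fintype ι] (h : IsMinimalSyzygy m ι K M) (B : Type u)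
    [CommRing B] [Algebra A B] [Module.Flat A B] :
    IsMinimalSyzygy (m.map (algebraMap A B)) ι (TensorProduct A B K) (TensorProduct A B M) := by
  classical
  obtain ⟨f, g, hf, hfg, hg, hm⟩ := h
  let e := TensorProduct.piScalarRight A B B ι
  refine ⟨e.toLinearMap.comp (f.baseChange B), (g.baseChange B).comp e.symm.toLinearMap,
    e.injective.comp (Module.Flat.lTensor_preserves_injective_linearMap f hf), ?_,
    (LinearMap.lTensor_surjective B hg).comp e.symm.surjective, ?_⟩
  · have := lTensor_exact B hfg hg
    intro x
    refine (this (e.symm x)).trans ?_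
    exact ⟨fun ⟨y, hy⟩ => ⟨y, (congrArg e hy).trans (e.apply_symm_apply x)⟩,
      fun ⟨y, hy⟩ => ⟨y, (e.symm_apply_apply _).symm.trans (congrArg e.symm hy)⟩⟩
  · intro x i
    induction x with
    | zero => simp
    | add x y hx hy => simpa using add_mem hx hy
    | tmul b x =>
      have : (e.toLinearMap.comp (f.baseChange B)) (b ⊗ₜ[A] x) i = f x i • b := by
        simp [e]
      rw [this, Algebra.smul_def]
      exact Ideal.mul_mem_right _ _ (Ideal.mem_map_of_mem _ (hm x i))

end MinimalSyzygy

/-! ### Modules of covariants over the rational normal curve -/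

section Covariants

open MvPolynomial

variable (k : Type u) [Field k] (δ : ℕ)

/-- The polynomials in two variables whose monomials have degree congruent to `j` modulo `δ`. -/
def degreeMod (j : ℕ) : Submodule k (MvPolynomial (Fin 2) k) where
  carrier := {f | ∀ d : Fin 2 →₀ ℕ, f.coeff d ≠ 0 → d 0 + d 1 ≡ j [MOD δ]}
  zero_mem' d h := absurd (coeff_zero d) h
  add_mem' {f g} hf hg d h := by
    rw [coeff_add] at h
    by_cases hfd : f.coeff d = 0
    · exact hg d fun h0 => h (by rw [hfd, h0, add_zero])
    · exact hf d hfd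
  smul_mem' c f hf d h := hf d fun h0 => h (by rw [coeff_smul, h0, smul_zero])

variable {k δ}

theorem degreeMod_congr {i j : ℕ} (h : i ≡ j [MOD δ]) : degreeMod k δ i = degreeMod k δ j := by
  ext f
  exact forall₂_congr fun d _ => ⟨fun h' => h'.trans h, fun h' => h'.trans h.symm⟩

theorem monomial_mem_degreeMod {j : ℕ} {d : Fin 2 →₀ ℕ} (h : d 0 + d 1 ≡ j [MOD δ]) (c : k) :
    monomial d c ∈ degreeMod k δ j := by
  classical
  intro d' h'
  rw [coeff_monomial] at h'
  split_ifs at h' with hd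
  · exact hd ▸ h
  · exact absurd rfl h'

theorem degreeMod_induction {j : ℕ} {P : MvPolynomial (Fin 2) k → Prop} (h0 : P 0)
    (hadd : ∀ f g, P f → P g → P (f + g))
    (hmon : ∀ (d : Fin 2 →₀ ℕ) (c : k), d 0 + d 1 ≡ j [MOD δ] → P (monomial d c))
    {f : MvPolynomial (Fin 2) k} (hf : f ∈ degreeMod k δ j) : P f := by
  rw [f.as_sum]
  refine Finset.sum_induction _ P hadd h0 fun d hd => hmon d _ (hf d (mem_support_iff.1 hd))

theorem mul_mem_degreeMod {i j : ℕ} {f g : MvPolynomial (Fin 2) k} (hf : f ∈ degreeMod k δ i)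
    (hg : g ∈ degreeMod k δ j) : f * g ∈ degreeMod k δ (i + j) := by
  classical
  intro d hd
  rw [coeff_mul] at hd
  obtain ⟨x, hx, hne⟩ := Finset.exists_ne_zero_of_sum_ne_zero hd
  have h1 := hf x.1 (left_ne_zero_of_mul hne)
  have h2 := hg x.2 (right_ne_zero_of_mul hne)
  rw [← Finset.HasAntidiagonal.mem_antidiagonal.1 hx]
  have := h1.add h2
  simp only [Finsupp.add_apply]
  convert this using 1
  ring

theorem X_mem_degreeMod (i : Fin 2) : (X i : MvPolynomial (Fin 2) k) ∈ degreeMod k δ 1 := by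
  refine monomial_mem_degreeMod ?_ 1
  fin_cases i <;> simp [Nat.ModEq]

theorem one_mem_degreeMod : (1 : MvPolynomial (Fin 2) k) ∈ degreeMod k δ 0 :=
  monomial_mem_degreeMod (d := 0) rfl 1

theorem pow_mem_degreeMod {i : ℕ} {f : MvPolynomial (Fin 2) k} (hf : f ∈ degreeMod k δ i) (n : ℕ) :
    f ^ n ∈ degreeMod k δ (n * i) := by
  induction n with
  | zero => simpa using one_mem_degreeMod
  | succ n ih =>
    rw [pow_succ, Nat.succ_mul]
    exact mul_mem_degreeMod ih hf

theorem X_pow_mul_X_pow_mem_degreeMod (a b : ℕ) :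
    (X 0 ^ a * X 1 ^ b : MvPolynomial (Fin 2) k) ∈ degreeMod k δ (a + b) := by
  simpa using mul_mem_degreeMod (pow_mem_degreeMod (X_mem_degreeMod (k := k) (δ := δ) 0) a)
    (pow_mem_degreeMod (X_mem_degreeMod 1) b)

theorem mem_degreeMod_of_X_mul_mem {i : Fin 2} {j : ℕ} {f : MvPolynomial (Fin 2) k}
    (h : X i * f ∈ degreeMod k δ (j + 1)) : f ∈ degreeMod k δ j := by
  intro d hd
  have := h (Finsupp.single i 1 + d) (by rwa [coeff_X_mul])
  refine Nat.ModEq.add_right_cancel' 1 ?_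
  convert this using 1
  fin_cases i <;> simp <;> ring

theorem monomial_eq_X_pow (d : Fin 2 →₀ ℕ) (c : k) :
    monomial d c = C c * (X 0 ^ d 0 * X 1 ^ d 1) := by
  rw [monomial_eq, Finsupp.prod_fintype _ _ (by simp), Fin.prod_univ_two]


theorem X_pow_mul_X_pow_mem_ratNormalCurve {a b : ℕ} (h : δ ∣ a + b) :
    (X 0 ^ a * X 1 ^ b : MvPolynomial (Fin 2) k) ∈ ratNormalCurve k δ := by
  obtain ⟨n, hn⟩ := h
  induction n generalizing a b with
  | zero =>
    obtain ⟨rfl, rfl⟩ : a = 0 ∧ b = 0 := by omega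
    simp
  | succ n ih =>
    obtain ⟨a', b', ha, hb, hab⟩ : ∃ a' b', a' ≤ a ∧ b' ≤ b ∧ a' + b' = δ :=
      ⟨min a δ, δ - min a δ, by omega, by rw [Nat.mul_succ] at hn; omega, by omega⟩
    have h1 : (X 0 ^ a' * X 1 ^ b' : MvPolynomial (Fin 2) k) ∈ ratNormalCurve k δ :=
      Algebra.subset_adjoin ⟨a', b', hab, rfl⟩
    have h2 := ih (a := a - a') (b := b - b') (by rw [Nat.mul_succ] at hn; omega)
    have := mul_mem h1 h2
    rwa [mul_mul_mul_comm, ← pow_add, ← pow_add, Nat.add_sub_cancel' ha,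
      Nat.add_sub_cancel' hb] at this

theorem mem_ratNormalCurve_iff {f : MvPolynomial (Fin 2) k} :
    f ∈ ratNormalCurve k δ ↔ f ∈ degreeMod k δ 0 := by
  constructor
  · intro hf
    induction hf using Algebra.adjoin_induction with
    | mem x hx =>
      obtain ⟨a, b, hab, rfl⟩ := hx
      have := X_pow_mul_X_pow_mem_degreeMod (k := k) (δ := δ) a b
      rwa [degreeMod_congr (i := a + b) (j := 0) (by rw [hab]; simp [Nat.ModEq])] at this
    | algebraMap r => exact monomial_mem_degreeMod (d := 0) rfl r
    | add x y _ _ hx hy => exact add_mem hx hy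
    | mul x y _ _ hx hy => exact mul_mem_degreeMod hx hy
  · intro hf
    refine degreeMod_induction (P := (· ∈ ratNormalCurve k δ)) (zero_mem _)
      (fun _ _ => add_mem) (fun d c h => ?_) hf
    rw [monomial_eq_X_pow]
    exact mul_mem ((ratNormalCurve k δ).algebraMap_mem c)
      (X_pow_mul_X_pow_mem_ratNormalCurve ((Nat.modEq_zero_iff_dvd).1 h))

theorem mem_homMaxIdeal_iff {r : ratNormalCurve k δ} :
    r ∈ homMaxIdeal k δ ↔ constantCoeff (r : MvPolynomial (Fin 2) k) = 0 := Iff.rfl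

variable (k δ) in
/-- The module of covariants `⨁ S_n` over `n ≡ j` modulo `δ`, where `S` is the polynomial ring in
two variables. -/
def covariants (j : ℕ) : Submodule (ratNormalCurve k δ) (MvPolynomial (Fin 2) k) where
  carrier := degreeMod k δ j
  zero_mem' := zero_mem _
  add_mem' := add_mem
  smul_mem' r f hf := by
    have := mul_mem_degreeMod (mem_ratNormalCurve_iff.1 r.2) hf
    rwa [zero_add] at this

theorem mem_covariants {j : ℕ} {f : MvPolynomial (Fin 2) k} :
    f ∈ covariants k δ j ↔ f ∈ degreeMod k δ j := Iff.rfl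

instance (j : ℕ) : AddCommGroup (covariants k δ j) := Submodule.addCommGroup _

instance (j : ℕ) : Module (ratNormalCurve k δ) (covariants k δ j) := Submodule.module _

instance (j : ℕ) : SMul (ratNormalCurve k δ) (covariants k δ j) := Submodule.smul _

instance (ι : Type) (j : ℕ) : Module (ratNormalCurve k δ) (ι → covariants k δ j) :=
  Pi.module _ _ _

instance (ι : Type) (j : ℕ) : SMul (ratNormalCurve k δ) (ι → covariants k δ j) :=
  Pi.instSMul

instance (ι : Type) : Module (ratNormalCurve k δ) (ι → ratNormalCurve k δ) :=
  Pi.module _ _ _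

instance (ι : Type) : SMul (ratNormalCurve k δ) (ι → ratNormalCurve k δ) :=
  Pi.instSMul

/-- The monomial generators of the module of covariants. -/
def covariantsGen (j : ℕ) (i : Fin (j + 1)) : covariants k δ j :=
  ⟨X 0 ^ (j - i : ℕ) * X 1 ^ (i : ℕ), by
    have := X_pow_mul_X_pow_mem_degreeMod (k := k) (δ := δ) (j - i) i
    rwa [Nat.sub_add_cancel (Nat.lt_succ_iff.1 i.2)] at this⟩

theorem span_covariantsGen {j : ℕ} (hj : j < δ) :
    Submodule.span (ratNormalCurve k δ) (Set.range (covariantsGen (k := k) (δ := δ) j)) = ⊤ := by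
  have key : ∀ f, f ∈ degreeMod k δ j → f ∈ (Submodule.span (ratNormalCurve k δ)
      (Set.range (covariantsGen (k := k) (δ := δ) j))).map (covariants k δ j).subtype := by
    intro f hf
    refine degreeMod_induction (P := (· ∈ (Submodule.span (ratNormalCurve k δ)
      (Set.range (covariantsGen (k := k) (δ := δ) j))).map (covariants k δ j).subtype))
      (zero_mem _) (fun _ _ => add_mem) (fun d c h => ?_) hf
    have hle : j ≤ d 0 + d 1 := by
      by_contra hlt
      have := h.eq_of_lt_of_lt (by omega) hj
      omega
    obtain ⟨a', b', ha, hb, hab⟩ : ∃ a' b', a' ≤ d 0 ∧ b' ≤ d 1 ∧ a' + b' = j :=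
      ⟨min (d 0) j, j - min (d 0) j, by omega, by omega, by omega⟩
    have hr : C c * (X 0 ^ (d 0 - a') * X 1 ^ (d 1 - b')) ∈ ratNormalCurve k δ := by
      refine mul_mem ((ratNormalCurve k δ).algebraMap_mem c)
        (X_pow_mul_X_pow_mem_ratNormalCurve ?_)
      have := (Nat.modEq_iff_dvd' hle).1 h.symm
      convert this using 1
      omega
    refine ⟨(⟨_, hr⟩ : ratNormalCurve k δ) • covariantsGen j ⟨b', by omega⟩,
      Submodule.smul_mem _ _ (Submodule.subset_span ⟨_, rfl⟩), ?_⟩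
    rw [map_smul, Submodule.subtype_apply, Subalgebra.smul_def, smul_eq_mul]
    simp only [covariantsGen]
    rw [show j - b' = a' by omega, mul_assoc, mul_mul_mul_comm, ← pow_add, ← pow_add,
      Nat.sub_add_cancel ha, Nat.sub_add_cancel hb, monomial_eq_X_pow]
  refine Submodule.eq_top_iff'.2 fun f => ?_
  obtain ⟨g, hg, hgf⟩ := key f f.2
  rwa [← Subtype.ext hgf]

theorem X_not_dvd_X_pow {i i' : Fin 2} (h : i ≠ i') (j : ℕ) :
    ¬ (X i : MvPolynomial (Fin 2) k) ∣ X i' ^ j := by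
  intro hdvd
  have := (X_prime (R := k) (i := i)).dvd_of_dvd_pow hdvd
  rw [X_dvd_X] at this
  exact h this

/-- Exactness in the middle of the sequence `S^j → S^(j+1) → S` given by the monomials of
degree `j`. -/
theorem exists_eq_of_sum_mul_X_pow_eq_zero (j : ℕ) (r : Fin (j + 1) → MvPolynomial (Fin 2) k)
    (h : ∑ i, r i * (X 0 ^ (j - i : ℕ) * X 1 ^ (i : ℕ)) = 0) :
    ∃ t : Fin j → MvPolynomial (Fin 2) k, ∀ i : Fin (j + 1),
      r i = X 1 * (Fin.snoc t 0 : Fin (j + 1) → MvPolynomial (Fin 2) k) i -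
        X 0 * (Fin.cons 0 t : Fin (j + 1) → MvPolynomial (Fin 2) k) i := by
  induction j with
  | zero =>
    refine ⟨Fin.elim0, fun i => ?_⟩
    have hi : i = 0 := Fin.fin_one_eq_zero i
    subst hi
    simp at h
    simp [h, Fin.snoc]
  | succ j ih =>
    have hsum : ∑ i : Fin (j + 1), r i.succ * (X 0 ^ (j + 1 - i.succ : ℕ) * X 1 ^ (i.succ : ℕ)) =
        X 1 * ∑ i : Fin (j + 1), r i.succ * (X 0 ^ (j - i : ℕ) * X 1 ^ (i : ℕ)) := by
      rw [Finset.mul_sum]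
      refine Finset.sum_congr rfl fun i _ => ?_
      rw [Fin.val_succ, Nat.add_sub_add_right, pow_succ]
      ring
    rw [Fin.sum_univ_succ, hsum] at h
    simp only [Fin.val_zero, Nat.sub_zero, pow_zero, mul_one] at h
    have hdvd : (X 1 : MvPolynomial (Fin 2) k) ∣ r 0 * X 0 ^ (j + 1) :=
      ⟨-∑ i : Fin (j + 1), r i.succ * (X 0 ^ (j - i : ℕ) * X 1 ^ (i : ℕ)), by
        rw [mul_neg]; exact eq_neg_of_add_eq_zero_left h⟩
    obtain ⟨t₀, ht₀⟩ := ((X_prime (R := k) (i := (1 : Fin 2))).dvd_or_dvd hdvd).resolve_right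
      (X_not_dvd_X_pow (by simp) _)
    rw [ht₀, mul_assoc, ← mul_add] at h
    have h' := (mul_eq_zero.1 h).resolve_left (X_ne_zero 1)
    obtain ⟨t, ht⟩ := ih (fun i => r i.succ + X 0 * (Fin.cons t₀ 0 : Fin (j + 1) → _) i) (by
      simp only [add_mul, Finset.sum_add_distrib]
      rw [Fin.sum_univ_succ (fun i : Fin (j + 1) => X 0 * (Fin.cons t₀ 0 : Fin (j + 1) → _) i *
        (X 0 ^ (j - i : ℕ) * X 1 ^ (i : ℕ)))]
      simp only [Fin.cons_zero, Fin.cons_succ, Pi.zero_apply, mul_zero, zero_mul,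
        Finset.sum_const_zero, Fin.val_zero, pow_zero, mul_one, add_zero, Nat.sub_zero]
      rw [← h', pow_succ]
      ring)
    refine ⟨Fin.cons t₀ t, fun i => ?_⟩
    rw [← Fin.cons_snoc_eq_snoc_cons]
    refine Fin.cases ?_ (fun i => ?_) i
    · simp [ht₀]
    · have := ht i
      rw [Fin.cons_succ, Fin.cons_succ, eq_sub_of_add_eq this]
      refine Fin.cases ?_ (fun i => ?_) i
      · simp
      · simp

theorem mem_degreeMod_of_snoc_sub_cons {j n : ℕ} {t : Fin j → MvPolynomial (Fin 2) k}
    (h : ∀ i : Fin (j + 1), X 1 * (Fin.snoc t 0 : Fin (j + 1) → MvPolynomial (Fin 2) k) i -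
        X 0 * (Fin.cons 0 t : Fin (j + 1) → MvPolynomial (Fin 2) k) i ∈ degreeMod k δ (n + 1))
    (i : Fin j) : t i ∈ degreeMod k δ n := by
  obtain ⟨i, hi⟩ := i
  induction i with
  | zero =>
    have := h (Fin.castSucc ⟨0, hi⟩)
    rw [Fin.snoc_castSucc] at this
    have h0 : Fin.castSucc (⟨0, hi⟩ : Fin j) = 0 := rfl
    rw [h0, Fin.cons_zero, mul_zero, sub_zero] at this
    exact mem_degreeMod_of_X_mul_mem this
  | succ i ih =>
    have := h (Fin.castSucc ⟨i + 1, hi⟩)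
    rw [Fin.snoc_castSucc] at this
    have h0 : Fin.castSucc (⟨i + 1, hi⟩ : Fin j) = Fin.succ ⟨i, by omega⟩ := rfl
    rw [h0, Fin.cons_succ] at this
    have h2 := mul_mem_degreeMod (X_mem_degreeMod (k := k) (δ := δ) 0) (ih (by omega))
    rw [add_comm] at h2
    exact mem_degreeMod_of_X_mul_mem (by simpa using add_mem this h2)

theorem eq_zero_of_snoc_sub_cons_eq_zero {j : ℕ} {t : Fin j → MvPolynomial (Fin 2) k}
    (h : ∀ i : Fin (j + 1), X 1 * (Fin.snoc t 0 : Fin (j + 1) → MvPolynomial (Fin 2) k) i -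
        X 0 * (Fin.cons 0 t : Fin (j + 1) → MvPolynomial (Fin 2) k) i = 0)
    (i : Fin j) : t i = 0 := by
  obtain ⟨i, hi⟩ := i
  induction i with
  | zero =>
    have := h (Fin.castSucc ⟨0, hi⟩)
    rw [Fin.snoc_castSucc] at this
    have h0 : Fin.castSucc (⟨0, hi⟩ : Fin j) = 0 := rfl
    rw [h0, Fin.cons_zero, mul_zero, sub_zero] at this
    exact (mul_eq_zero.1 this).resolve_left (X_ne_zero 1)
  | succ i ih =>
    have := h (Fin.castSucc ⟨i + 1, hi⟩)
    rw [Fin.snoc_castSucc] at this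
    have h0 : Fin.castSucc (⟨i + 1, hi⟩ : Fin j) = Fin.succ ⟨i, by omega⟩ := rfl
    rw [h0, Fin.cons_succ, ih (by omega), mul_zero, sub_zero] at this
    exact (mul_eq_zero.1 this).resolve_left (X_ne_zero 1)

variable (k δ) in
/-- Multiplication by a variable, as a map from the last module of covariants to the ring. -/
def covariantsMulX (hδ : 1 ≤ δ) (i : Fin 2) :
    covariants k δ (δ - 1) →ₗ[ratNormalCurve k δ] ratNormalCurve k δ where
  toFun t := ⟨X i * (t : MvPolynomial (Fin 2) k), by
    have := mul_mem_degreeMod (X_mem_degreeMod (k := k) (δ := δ) i) t.2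
    rw [mem_ratNormalCurve_iff]
    rwa [degreeMod_congr (j := 0) (by rw [Nat.add_sub_cancel' hδ]; simp [Nat.ModEq])] at this⟩
  map_add' s t := Subtype.ext (mul_add _ _ _)
  map_smul' r t := Subtype.ext (mul_left_comm _ _ _)

/-- The linear map `t ↦ (a tᵢ - b tᵢ₋₁)ᵢ`. -/
def shiftDifference {A N P : Type*} [CommRing A] [AddCommGroup N] [Module A N] [AddCommGroup P]
    [Module A P] (a b : N →ₗ[A] P) (j : ℕ) : (Fin j → N) →ₗ[A] Fin (j + 1) → P where
  toFun t i := a ((Fin.snoc t 0 : Fin (j + 1) → N) i) - b ((Fin.cons 0 t : Fin (j + 1) → N) i)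
  map_add' s t := by
    funext i
    have h1 : (Fin.snoc (s + t) 0 : Fin (j + 1) → N) i =
        (Fin.snoc s 0 : Fin (j + 1) → N) i + (Fin.snoc t 0 : Fin (j + 1) → N) i := by
      refine Fin.lastCases ?_ (fun i => ?_) i <;> simp
    have h2 : (Fin.cons 0 (s + t) : Fin (j + 1) → N) i =
        (Fin.cons 0 s : Fin (j + 1) → N) i + (Fin.cons 0 t : Fin (j + 1) → N) i := by
      refine Fin.cases ?_ (fun i => ?_) i <;> simp
    rw [h1, h2, map_add, map_add]
    exact add_sub_add_comm _ _ _ _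
  map_smul' r t := by
    funext i
    have h1 : (Fin.snoc (r • t) 0 : Fin (j + 1) → N) i =
        r • (Fin.snoc t 0 : Fin (j + 1) → N) i := by
      refine Fin.lastCases ?_ (fun i => ?_) i <;> simp
    have h2 : (Fin.cons 0 (r • t) : Fin (j + 1) → N) i =
        r • (Fin.cons 0 t : Fin (j + 1) → N) i := by
      refine Fin.cases ?_ (fun i => ?_) i <;> simp
    rw [h1, h2, map_smul, map_smul, ← smul_sub]
    rfl

theorem isMinimalSyzygy_covariants (hδ : 1 ≤ δ) {j : ℕ} (hj : j < δ) :
    IsMinimalSyzygy (homMaxIdeal k δ) (Fin (j + 1)) (Fin j → covariants k δ (δ - 1))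
      (covariants k δ j) := by
  let f := shiftDifference (covariantsMulX k δ hδ 1) (covariantsMulX k δ hδ 0) j
  have hf : ∀ t i, ((f t i : ratNormalCurve k δ) : MvPolynomial (Fin 2) k) =
      X 1 * (Fin.snoc (fun i => (t i : MvPolynomial (Fin 2) k)) 0 : Fin (j + 1) → _) i -
        X 0 * (Fin.cons 0 (fun i => (t i : MvPolynomial (Fin 2) k)) : Fin (j + 1) → _) i := by
    intro t i
    have h1 : (((Fin.snoc t 0 : Fin (j + 1) → covariants k δ (δ - 1)) i :
        covariants k δ (δ - 1)) : MvPolynomial (Fin 2) k) =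
          (Fin.snoc (fun i => (t i : MvPolynomial (Fin 2) k)) 0 : Fin (j + 1) → _) i := by
      refine Fin.lastCases ?_ (fun i => ?_) i <;> simp
    have h2 : (((Fin.cons 0 t : Fin (j + 1) → covariants k δ (δ - 1)) i :
        covariants k δ (δ - 1)) : MvPolynomial (Fin 2) k) =
          (Fin.cons 0 (fun i => (t i : MvPolynomial (Fin 2) k)) : Fin (j + 1) → _) i := by
      refine Fin.cases ?_ (fun i => ?_) i <;> simp
    rw [← h1, ← h2]
    rfl
  have hg : ∀ r : Fin (j + 1) → ratNormalCurve k δ,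
      ((Fintype.linearCombination (ratNormalCurve k δ) (covariantsGen j) r : covariants k δ j) :
        MvPolynomial (Fin 2) k) =
      ∑ i, (r i : MvPolynomial (Fin 2) k) * (X 0 ^ (j - i : ℕ) * X 1 ^ (i : ℕ)) := by
    intro r
    rw [Fintype.linearCombination_apply, Submodule.coe_sum]
    rfl
  refine ⟨f, Fintype.linearCombination _ (covariantsGen j), ?_, ?_, ?_, ?_⟩
  · refine (injective_iff_map_eq_zero f).2 fun t ht => funext fun i => Subtype.ext ?_
    refine eq_zero_of_snoc_sub_cons_eq_zero (t := fun i => (t i : MvPolynomial (Fin 2) k))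
      (fun i => ?_) i
    rw [← hf, ht]
    rfl
  · intro r
    constructor
    · intro hr
      have h0 := (hg r).symm.trans (congrArg Subtype.val hr)
      obtain ⟨t, ht⟩ := exists_eq_of_sum_mul_X_pow_eq_zero j _ h0
      have hmem : ∀ i, t i ∈ degreeMod k δ (δ - 1) := by
        refine mem_degreeMod_of_snoc_sub_cons fun i => ?_
        rw [← ht, degreeMod_congr (j := 0) (by rw [Nat.sub_add_cancel hδ]; simp [Nat.ModEq])]
        exact mem_ratNormalCurve_iff.1 (r i).2
      refine ⟨fun i => ⟨t i, hmem i⟩, funext fun i => Subtype.ext ?_⟩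
      rw [hf, ht]
    · rintro ⟨t, rfl⟩
      apply Subtype.ext
      rw [hg]
      simp only [hf, sub_mul, Finset.sum_sub_distrib]
      rw [Fin.sum_univ_castSucc, Fin.sum_univ_succ (fun i : Fin (j + 1) => X 0 * _ * _)]
      simp only [Fin.snoc_castSucc, Fin.snoc_last, Fin.cons_succ, Fin.cons_zero, mul_zero,
        zero_mul, add_zero, zero_add]
      refine sub_eq_zero.2 ?_
      refine Finset.sum_congr rfl fun i _ => ?_
      rw [Fin.val_castSucc, Fin.val_succ, show j - i = j - (i + 1) + 1 by omega, pow_succ, pow_succ]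
      ring
  · rw [← LinearMap.range_eq_top, Fintype.range_linearCombination, span_covariantsGen hj]
  · intro t i
    rw [mem_homMaxIdeal_iff, hf]
    simp

end Covariants

/-! ### The Frobenius pushforward of the rational normal curve -/

section Decomposition

open MvPolynomial

/-- The index set of the decomposition of the Frobenius pushforward of the rational normal curve
into modules of covariants: `(a, b, j)` stands for the copy of the `j`-th module of covariants
generated by `x ^ a * y ^ b`. -/
abbrev FrobIndex (q δ : ℕ) : Type :=
  {t : Fin q × Fin q × Fin δ // δ ∣ q * t.2.2 + (t.1 + t.2.1)}

/-- The exponent of the monomial `x ^ a * y ^ b`. -/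
def exponent (a b : ℕ) : Fin 2 →₀ ℕ := Finsupp.single 0 a + Finsupp.single 1 b

@[simp] theorem exponent_zero (a b : ℕ) : exponent a b 0 = a := by simp [exponent]

@[simp] theorem exponent_one (a b : ℕ) : exponent a b 1 = b := by simp [exponent]

variable {k : Type u} [Field k] (p : ℕ) [Fact p.Prime] [CharP k p] (e : ℕ) {δ : ℕ}

theorem coeff_pow_mul_monomial (f : MvPolynomial (Fin 2) k) {a b : ℕ} (d : Fin 2 →₀ ℕ) :
    coeff (p ^ e • d + exponent a b) (f ^ p ^ e * monomial (exponent a b) 1) =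
      coeff d f ^ p ^ e := by
  have hq : p ^ e ≠ 0 := pow_ne_zero _ (Fact.out : p.Prime).ne_zero
  rw [coeff_mul_monomial, mul_one, ← map_iterateFrobenius_expand p f e, coeff_map,
    coeff_expand_smul _ hq, iterateFrobenius_def]

theorem coeff_pow_mul_monomial_of_ne (f : MvPolynomial (Fin 2) k) {a b a' b' : ℕ}
    (ha : a < p ^ e) (hb : b < p ^ e) (ha' : a' < p ^ e) (hb' : b' < p ^ e)
    (h : ¬ (a = a' ∧ b = b')) (d : Fin 2 →₀ ℕ) :
    coeff (p ^ e • d + exponent a' b') (f ^ p ^ e * monomial (exponent a b) 1) = 0 := by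
  have key : ∀ {n c c' : ℕ}, c < p ^ e → c' < p ^ e → c ≠ c' → c ≤ p ^ e * n + c' →
      ¬ p ^ e ∣ p ^ e * n + c' - c := by
    intro n c c' hc hc' hne hle hdvd
    have h1 : c' ≡ c [MOD p ^ e] := by
      have := (Nat.modEq_iff_dvd' hle).2 hdvd
      have h2 : p ^ e * n + c' ≡ c' [MOD p ^ e] := by simp [Nat.ModEq]
      exact (this.trans h2).symm
    exact hne (h1.eq_of_lt_of_lt hc' hc).symm
  rw [coeff_mul_monomial']
  split_ifs with hle
  · rw [mul_one, ← map_iterateFrobenius_expand p f e, coeff_map]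
    have h0 := hle 0
    have h1 := hle 1
    simp only [exponent_zero, exponent_one, Finsupp.add_apply, Finsupp.smul_apply,
      smul_eq_mul] at h0 h1
    by_cases haa : a = a'
    · rw [coeff_expand_of_not_dvd (i := 1), map_zero]
      simpa using key hb hb' (fun hbb => h ⟨haa, hbb⟩) h1
    · rw [coeff_expand_of_not_dvd (i := 0), map_zero]
      simpa using key ha ha' haa h0
  · rfl

/-- The embedding of a module of covariants into the Frobenius pushforward. -/
def frobSummand (t : FrobIndex (p ^ e) δ) :
    covariants k δ t.1.2.2 →ₗ[ratNormalCurve k δ] FrobPush (ratNormalCurve k δ) p e where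
  toFun f := (⟨(f : MvPolynomial (Fin 2) k) ^ p ^ e * monomial (exponent t.1.1 t.1.2.1) 1, by
    have h1 := pow_mem_degreeMod (mem_covariants.1 f.2) (p ^ e)
    have h2 := monomial_mem_degreeMod (k := k) (δ := δ) (d := exponent t.1.1 t.1.2.1)
      (j := t.1.1 + t.1.2.1) (by simp; rfl) 1
    have h3 := mul_mem_degreeMod h1 h2
    rw [degreeMod_congr ((Nat.modEq_zero_iff_dvd).2 t.2)] at h3
    exact mem_ratNormalCurve_iff.2 h3⟩ : ratNormalCurve k δ)
  map_add' f g := Subtype.ext <| by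
    change ((f : MvPolynomial (Fin 2) k) + g) ^ p ^ e * _ = _ + _
    rw [add_pow_expChar_pow, add_mul]
  map_smul' r f := Subtype.ext <| by
    change ((r : MvPolynomial (Fin 2) k) * f) ^ p ^ e * _ = r ^ p ^ e * (f ^ p ^ e * _)
    rw [mul_pow, mul_assoc]

variable (k δ) in
/-- The sum of the embeddings of the modules of covariants. -/
def frobSum : (∀ t : FrobIndex (p ^ e) δ, covariants k δ t.1.2.2) →ₗ[ratNormalCurve k δ]
    FrobPush (ratNormalCurve k δ) p e :=
  ∑ t, (frobSummand p e t).comp (LinearMap.proj t)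

/-- The polynomial underlying an element of the Frobenius pushforward. -/
def FrobPush.toPoly : FrobPush (ratNormalCurve k δ) p e →+ MvPolynomial (Fin 2) k :=
  (ratNormalCurve k δ).toSubring.subtype.toAddMonoidHom

theorem FrobPush.toPoly_injective :
    Function.Injective (FrobPush.toPoly (k := k) (δ := δ) p e) := Subtype.val_injective

theorem toPoly_frobSum (F : ∀ t : FrobIndex (p ^ e) δ, covariants k δ t.1.2.2) :
    FrobPush.toPoly p e (frobSum k p e δ F) =
      ∑ t, (F t : MvPolynomial (Fin 2) k) ^ p ^ e * monomial (exponent t.1.1 t.1.2.1) 1 := by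
  rw [frobSum, LinearMap.sum_apply, map_sum]
  rfl

theorem frobSum_injective : Function.Injective (frobSum k p e δ) := by
  refine (injective_iff_map_eq_zero _).2 fun F hF => funext fun t => Subtype.ext ?_
  have h0 := toPoly_frobSum p e F
  rw [hF, map_zero] at h0
  ext d
  by_contra hne
  have hd : d 0 + d 1 ≡ t.1.2.2 [MOD δ] := (F t).2 d hne
  have h1 := congrArg (coeff (p ^ e • d + exponent t.1.1 t.1.2.1)) h0
  rw [coeff_zero, coeff_sum, Finset.sum_eq_single t, coeff_pow_mul_monomial] at h1
  · exact hne (pow_eq_zero_iff (pow_ne_zero _ (Fact.out : p.Prime).ne_zero) |>.1 h1.symm)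
  · intro s _ hst
    by_cases hab : (s.1.1 : ℕ) = t.1.1 ∧ (s.1.2.1 : ℕ) = t.1.2.1
    · rw [← hab.1, ← hab.2, coeff_pow_mul_monomial]
      have : coeff d (F s : MvPolynomial (Fin 2) k) = 0 := by
        by_contra hs
        have hs' : d 0 + d 1 ≡ s.1.2.2 [MOD δ] := (F s).2 d hs
        have := (hs'.symm.trans hd).eq_of_lt_of_lt s.1.2.2.2 t.1.2.2.2
        exact hst (Subtype.ext (Prod.ext (Fin.ext hab.1) (Prod.ext (Fin.ext hab.2) (Fin.ext this))))
      rw [this, zero_pow (pow_ne_zero _ (Fact.out : p.Prime).ne_zero)]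
    · exact coeff_pow_mul_monomial_of_ne p e _ s.1.1.2 s.1.2.1.2 t.1.1.2 t.1.2.1.2 hab d
  · exact fun h => absurd (Finset.mem_univ t) h

theorem frobSum_surjective [IsAlgClosed k] (hδ : 1 ≤ δ) :
    Function.Surjective (frobSum k p e δ) := by
  classical
  have hq : 0 < p ^ e := pow_pos (Fact.out : p.Prime).pos _
  have key : ∀ g ∈ degreeMod k δ 0, ∃ F, FrobPush.toPoly p e (frobSum k p e δ F) = g := by
    intro g hg
    refine degreeMod_induction (P := fun g => ∃ F, FrobPush.toPoly p e (frobSum k p e δ F) = g)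
      ⟨0, by rw [map_zero, map_zero]⟩ ?_ ?_ hg
    · rintro _ _ ⟨F, rfl⟩ ⟨G, rfl⟩
      exact ⟨F + G, by rw [map_add, map_add]⟩
    · intro d c hd
      obtain ⟨c', rfl⟩ := IsAlgClosed.exists_pow_nat_eq c hq
      let t : FrobIndex (p ^ e) δ := ⟨(⟨d 0 % p ^ e, Nat.mod_lt _ hq⟩,
        ⟨d 1 % p ^ e, Nat.mod_lt _ hq⟩,
        ⟨(d 0 / p ^ e + d 1 / p ^ e) % δ, Nat.mod_lt _ hδ⟩), by
          refine (Nat.modEq_zero_iff_dvd).1 ?_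
          refine (((Nat.mod_modEq _ _).mul_left _).add_right _).trans (Nat.ModEq.trans ?_ hd)
          have h0 := Nat.div_add_mod (d 0) (p ^ e)
          have h1 := Nat.div_add_mod (d 1) (p ^ e)
          refine congrArg (· % δ) ?_
          dsimp only
          rw [mul_add]
          omega⟩
      refine ⟨Pi.single t ⟨monomial (exponent (d 0 / p ^ e) (d 1 / p ^ e)) c',
        monomial_mem_degreeMod (by simpa using (Nat.mod_modEq _ _).symm) _⟩, ?_⟩
      rw [toPoly_frobSum, Finset.sum_eq_single t]
      · rw [Pi.single_eq_same, monomial_pow, monomial_mul, mul_one]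
        congr 2
        rw [Finsupp.ext_iff, Fin.forall_fin_two]
        simp [t, Nat.div_add_mod]
      · intro s _ hst
        rw [Pi.single_eq_of_ne hst]
        change (0 : MvPolynomial (Fin 2) k) ^ p ^ e * _ = 0
        rw [zero_pow hq.ne', zero_mul]
      · exact fun h => absurd (Finset.mem_univ t) h
  intro g
  obtain ⟨F, hF⟩ := key (FrobPush.toPoly p e g)
    (mem_ratNormalCurve_iff.1 (show ratNormalCurve k δ from g).2)
  exact ⟨F, FrobPush.toPoly_injective p e hF⟩

variable (k δ) in
/-- The Frobenius pushforward of the rational normal curve is a direct sum of modules of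
covariants. -/
def frobPushEquiv [IsAlgClosed k] (hδ : 1 ≤ δ) :
    (∀ t : FrobIndex (p ^ e) δ, covariants k δ t.1.2.2) ≃ₗ[ratNormalCurve k δ]
      FrobPush (ratNormalCurve k δ) p e :=
  LinearEquiv.ofBijective (frobSum k p e δ) ⟨frobSum_injective p e, frobSum_surjective p e hδ⟩

end Decomposition

/-! ### Localization of the Frobenius pushforward -/

section Localization

variable {R : Type u} [CommRing R] (p : ℕ) [Fact p.Prime] [CharP R p] (W : Submonoid R)
  (A : Type u) [CommRing A] [CharP A p] [Algebra R A] [IsLocalization W A] (e : ℕ)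

include W in
theorem nonempty_tensor_frobPush_equiv :
    Nonempty (A ⊗[R] FrobPush R p e ≃ₗ[A] FrobPush A p e) := by
  let _ : Module R (FrobPush A p e) := Module.compHom _ (algebraMap R A)
  have hsmul : ∀ (r : R) (x : FrobPush A p e), r • x = algebraMap R A r • x := fun _ _ => rfl
  have : IsScalarTower R A (FrobPush A p e) :=
    ⟨fun r a x => by rw [hsmul, smul_smul, Algebra.smul_def]⟩
  let f : FrobPush R p e →ₗ[R] FrobPush A p e :=
    { toFun := fun x => algebraMap R A x
      map_add' := fun x y => map_add (algebraMap R A) x y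
      map_smul' := fun r x => by
        change algebraMap R A (r ^ p ^ e * (show R from x)) =
          (algebraMap R A r) ^ p ^ e * algebraMap R A (show R from x)
        rw [map_mul, map_pow] }
  have : IsLocalizedModule W f := by
    refine ⟨fun w => ?_, fun y => ?_, fun {x y} hxy => ?_⟩
    · obtain ⟨v, hv⟩ := IsLocalization.map_units A w
      rw [Module.End.isUnit_iff]
      have hw : ∀ x : FrobPush A p e, algebraMap R (Module.End R (FrobPush A p e)) w x =
          (v : A) • x := fun x => by rw [Module.algebraMap_end_apply, hsmul, hv]
      constructor
      · intro x y hxy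
        rw [hw, hw] at hxy
        have := congrArg ((↑v⁻¹ : A) • ·) hxy
        simpa only [smul_smul, Units.inv_mul, one_smul] using this
      · intro y
        exact ⟨(↑v⁻¹ : A) • y, by rw [hw, smul_smul, Units.mul_inv, one_smul]⟩
    · obtain ⟨⟨r, w⟩, h⟩ := IsLocalization.surj W (show A from y)
      refine ⟨((w : R) ^ (p ^ e - 1) * r, w), ?_⟩
      change (algebraMap R A w) ^ p ^ e * (show A from y) =
        algebraMap R A ((w : R) ^ (p ^ e - 1) * r)
      rw [map_mul, ← h, map_pow, mul_comm (show A from y), ← mul_assoc, ← pow_succ,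
        Nat.sub_add_cancel (Nat.one_le_pow _ _ (Fact.out : p.Prime).pos)]
    · obtain ⟨c, hc⟩ := (IsLocalization.eq_iff_exists W A).1 hxy
      refine ⟨c, ?_⟩
      change (c : R) ^ p ^ e * (show R from x) = (c : R) ^ p ^ e * (show R from y)
      rw [← Nat.sub_add_cancel (Nat.one_le_pow e _ (Fact.out : p.Prime).pos), pow_succ, mul_assoc,
        mul_assoc]
      exact congrArg _ hc
  exact ⟨(IsLocalizedModule.isBaseChange W A f).equiv⟩

end Localization

section BaseChange

variable (R : Type u) [CommRing R] (A : Type u) [CommRing A] [Algebra R A]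

/-- The base change `A ⊗ M` of an `R`-module `M`. -/
def BaseChange (M : Type u) [AddCommGroup M] [Module R M] : Type u := A ⊗[R] M

variable (M : Type u) [AddCommGroup M] [Module R M]

instance : AddCommGroup (BaseChange R A M) := inferInstanceAs (AddCommGroup (A ⊗[R] M))

instance : Module A (BaseChange R A M) := inferInstanceAs (Module A (A ⊗[R] M))

variable {R M}

theorem IsMinimalSyzygy.baseChange_pi {m : Ideal R} {K : Type u} [AddCommGroup K] [Module R K]
    {ι κ : Type} [Fintype ι] [Fintype κ] (h : IsMinimalSyzygy m ι (κ → K) M) [Module.Flat R A] :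
    IsMinimalSyzygy (m.map (algebraMap R A)) ι (κ → BaseChange R A K) (BaseChange R A M) := by
  classical
  exact (h.baseChange A).congr (TensorProduct.piRight R A A fun _ : κ => K).symm
    (LinearEquiv.refl A _)

theorem nonempty_pi_baseChange_equiv_frobPush (p : ℕ) [Fact p.Prime] [CharP R p] [CharP A p]
    (W : Submonoid R) [IsLocalization W A] (e : ℕ) {T : Type} [Fintype T] {N : T → Type u}
    [∀ t, AddCommGroup (N t)] [∀ t, Module R (N t)] (ε : (∀ t, N t) ≃ₗ[R] FrobPush R p e) :
    Nonempty ((∀ t, BaseChange R A (N t)) ≃ₗ[A] FrobPush A p e) := by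
  classical
  obtain ⟨ε'⟩ := nonempty_tensor_frobPush_equiv p W A e
  exact ⟨(TensorProduct.piRight R A A N).symm ≪≫ₗ ε.baseChange R A _ _ ≪≫ₗ ε'⟩

theorem apply_mem_of_span_eq_top (n : Ideal A) {G : Set M} (hG : Submodule.span R G = ⊤)
    (h : ∀ g : M →ₗ[R] A, ∀ u ∈ G, g u ∈ n) (f : BaseChange R A M →ₗ[A] A)
    (x : BaseChange R A M) : f x ∈ n := by
  let f' : A ⊗[R] M →ₗ[A] A := f
  let g : M →ₗ[R] A := (f'.restrictScalars R).comp (TensorProduct.mk R A M 1)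
  have hg : ∀ u, g u ∈ n := by
    intro u
    have hu : u ∈ Submodule.span R G := hG ▸ trivial
    induction hu using Submodule.span_induction with
    | mem u hu => exact h g u hu
    | zero => rw [map_zero]; exact zero_mem _
    | add u v _ _ hu hv => rw [map_add]; exact add_mem hu hv
    | smul r u _ hu => rw [map_smul, Algebra.smul_def]; exact Ideal.mul_mem_left _ _ hu
  change f' x ∈ n
  change A ⊗[R] M at x
  induction x with
  | zero => rw [map_zero]; exact zero_mem _
  | add x y hx hy => rw [map_add]; exact add_mem hx hy
  | tmul a u =>
    have : a ⊗ₜ[R] u = a • ((1 : A) ⊗ₜ[R] u) := by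
      rw [TensorProduct.smul_tmul', smul_eq_mul, mul_one]
    rw [this, map_smul, smul_eq_mul]
    exact Ideal.mul_mem_left _ _ (hg u)

theorem nonempty_baseChange_equiv (ε : M ≃ₗ[R] R) : Nonempty (BaseChange R A M ≃ₗ[A] A) :=
  ⟨ε.baseChange R A _ _ ≪≫ₗ TensorProduct.AlgebraTensorModule.rid R A A⟩

end BaseChange

/-! ### Length and restriction of scalars -/

section Length

theorem length_eq_of_isFiniteLength {A B : Type u} [CommRing A] [CommRing B] [Algebra A B]
    (n : Ideal B) [n.IsMaximal] (h1 : Module.length A (B ⧸ n) = 1) {V : Type u} [AddCommGroup V]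
    [Module B V] (hV : IsFiniteLength B V) : ∀ [Module A V] [IsScalarTower A B V],
    (∀ b ∈ n, ∃ N : ℕ, ∀ v : V, b ^ N • v = 0) →
    Module.length A V = Module.length B V := by
  induction hV with
  | of_subsingleton =>
    intros
    rw [Module.length_eq_zero, Module.length_eq_zero]
  | @of_simple_quotient V _ _ N hs hN ih =>
    intro _ _ hn
    have hN' := ih fun b hb => by
      obtain ⟨M, hM⟩ := hn b hb
      exact ⟨M, fun v => Subtype.ext (hM v)⟩
    have hQ : Module.length A (V ⧸ N) = 1 := by
      obtain ⟨I, hI, ⟨f⟩⟩ := isSimpleModule_iff_quot_maximal.1 hs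
      have hnI : n ≤ I := by
        intro b hb
        obtain ⟨M, hM⟩ := hn b hb
        refine hI.isPrime.mem_of_pow_mem M ?_
        obtain ⟨v, hv⟩ := Submodule.mkQ_surjective N (f.symm 1)
        have : b ^ M • (1 : B ⧸ I) = 0 := by
          rw [← f.apply_symm_apply 1, ← hv, ← map_smul, ← map_smul, hM, map_zero, map_zero]
        rwa [← map_one (Ideal.Quotient.mk I), ← Ideal.Quotient.mk_eq_mk,
          ← Submodule.Quotient.mk_smul, smul_eq_mul, mul_one, Submodule.Quotient.mk_eq_zero] at this
      obtain rfl := Ideal.IsMaximal.eq_of_le ‹n.IsMaximal› hI.ne_top hnI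
      rw [← h1]
      exact (f.restrictScalars A).length_eq
    have hex : Function.Exact N.subtype N.mkQ := LinearMap.exact_subtype_mkQ N
    rw [Module.length_eq_add_of_exact N.subtype N.mkQ N.injective_subtype N.mkQ_surjective hex,
      Module.length_eq_add_of_exact (N.subtype.restrictScalars A) (N.mkQ.restrictScalars A)
        N.injective_subtype N.mkQ_surjective hex, hQ,
      Module.length_eq_one B (V ⧸ N)]
    exact congrArg (· + 1) hN'

/-- The ring `A` viewed as an algebra over itself through the iterated Frobenius. -/
def FrobRing (A : Type u) [CommRing A] (p : ℕ) [Fact p.Prime] [CharP A p] (_e : ℕ) : Type u := A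

variable (A : Type u) [CommRing A] (p : ℕ) [Fact p.Prime] [CharP A p] (e : ℕ)

instance : CommRing (FrobRing A p e) := inferInstanceAs (CommRing A)

instance : Algebra A (FrobRing A p e) := (iterateFrobenius A p e).toAlgebra

variable {A}

theorem length_quotient_frobPower (n : Ideal A) [n.IsMaximal]
    (hperf : Function.Surjective fun x : A ⧸ n => x ^ p ^ e)
    (hfin : Module.length A (FrobPush A p e ⧸ (n • ⊤ : Submodule A (FrobPush A p e))) ≠ ⊤) :
    Module.length A (A ⧸ frobPower p n e) =
      Module.length A (FrobPush A p e ⧸ (n • ⊤ : Submodule A (FrobPush A p e))) := by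
  let B := FrobRing A p e
  let J : Ideal B := (frobPower p n e : Ideal A)
  let n' : Ideal B := (n : Ideal A)
  have : n'.IsMaximal := ‹n.IsMaximal›
  let ε : FrobPush A p e ≃ₗ[A] B :=
    { toFun := fun x => x
      invFun := fun x => x
      left_inv := fun _ => rfl
      right_inv := fun _ => rfl
      map_add' := fun _ _ => rfl
      map_smul' := fun _ _ => rfl }
  have hJ : (n • ⊤ : Submodule A (FrobPush A p e)).map ε.toLinearMap = J.restrictScalars A := by
    apply le_antisymm
    · rw [Submodule.map_le_iff_le_comap, Submodule.smul_le]
      intro r hr x _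
      exact Ideal.mul_mem_right (show A from x) (frobPower p n e)
        (Ideal.subset_span ⟨r, hr, rfl⟩)
    · intro x hx
      change x ∈ Ideal.span ((fun r : A => r ^ p ^ e) '' (n : Set A)) at hx
      induction hx using Submodule.span_induction with
      | mem x hx =>
        obtain ⟨r, hr, rfl⟩ := hx
        exact ⟨r • (show FrobPush A p e from (1 : A)), Submodule.smul_mem_smul hr trivial,
          mul_one _⟩
      | zero => exact zero_mem _
      | add x y _ _ hx hy => exact add_mem hx hy
      | smul a x _ hx =>
        obtain ⟨y, hy, rfl⟩ := hx
        let μ : FrobPush A p e →ₗ[A] FrobPush A p e :=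
          { toFun := fun x => (a * (show A from x) : A)
            map_add' := fun x y => mul_add a (show A from x) (show A from y)
            map_smul' := fun r x => mul_left_comm a (r ^ p ^ e) (show A from x) }
        have hμ : (n • ⊤ : Submodule A (FrobPush A p e)) ≤
            (n • ⊤ : Submodule A (FrobPush A p e)).comap μ :=
          Submodule.smul_le.2 fun r hr x _ => by
            rw [Submodule.mem_comap, map_smul]
            exact Submodule.smul_mem_smul hr trivial
        exact ⟨μ y, hμ hy, rfl⟩
  have h1 : Module.length A (B ⧸ n') = 1 := by
    let _ : Field (B ⧸ n') := Ideal.Quotient.field n'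
    have hs : Function.Surjective (algebraMap A (B ⧸ n')) := by
      intro y
      obtain ⟨x, hx⟩ := hperf y
      obtain ⟨a, rfl⟩ := Ideal.Quotient.mk_surjective x
      exact ⟨a, hx⟩
    rw [Module.length_eq_of_surjective (R := B ⧸ n') hs]
    exact Module.length_eq_one _ _
  have h2 : Module.length A (B ⧸ J) =
      Module.length A (FrobPush A p e ⧸ (n • ⊤ : Submodule A (FrobPush A p e))) :=
    ((Submodule.Quotient.equiv _ _ ε hJ) ≪≫ₗ
      Submodule.Quotient.restrictScalarsEquiv A J).length_eq.symm
  have h3 : IsFiniteLength B (B ⧸ J) := by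
    rw [← Module.length_ne_top_iff]
    refine ne_top_of_le_ne_top (h2 ▸ hfin) ?_
    have := Submodule.length_le_length_restrictScalars A (⊤ : Submodule B (B ⧸ J))
    rw [Module.length_top] at this
    exact this.trans_eq (Module.length_top (R := A) (M := B ⧸ J))
  rw [← h2]
  exact (length_eq_of_isFiniteLength n' h1 h3 fun b hb => ⟨p ^ e, fun v => by
    obtain ⟨c, rfl⟩ := Submodule.mkQ_surjective J v
    rw [← map_smul]
    exact (Submodule.Quotient.mk_eq_zero J).2
      (Ideal.mul_mem_right c J (Ideal.subset_span ⟨b, hb, rfl⟩))⟩).symm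

end Length

/-! ### Free direct summands -/

section FreeSummand

variable {A : Type u} [CommRing A] {M M' : Type u} [AddCommGroup M] [Module A M]
  [AddCommGroup M'] [Module A M']

theorem hasFreeSummand_iff {c : ℕ} : HasFreeSummand A M c ↔
    ∃ (i : (Fin c → A) →ₗ[A] M) (π : M →ₗ[A] Fin c → A), ∀ x, π (i x) = x := by
  constructor
  · rintro ⟨P, Q, hPQ, ⟨e⟩⟩
    refine ⟨P.subtype.comp e.symm.toLinearMap,
      e.toLinearMap.comp (P.projectionOnto Q hPQ), fun x => ?_⟩
    simp
  · rintro ⟨i, π, h⟩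
    have hi : Function.Injective i := Function.LeftInverse.injective h
    refine ⟨LinearMap.range i, LinearMap.ker π, ?_, ⟨(LinearEquiv.ofInjective i hi).symm⟩⟩
    have hker : LinearMap.ker (i.rangeRestrict.comp π) = LinearMap.ker π := by
      ext x
      rw [LinearMap.mem_ker, LinearMap.mem_ker, LinearMap.comp_apply, Subtype.ext_iff]
      exact map_eq_zero_iff i hi
    rw [← hker]
    refine LinearMap.isCompl_of_proj ?_
    rintro ⟨_, x, rfl⟩
    exact Subtype.ext (congrArg i (h x))

theorem HasFreeSummand.congr {c : ℕ} (h : HasFreeSummand A M c) (e : M ≃ₗ[A] M') :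
    HasFreeSummand A M' c := by
  rw [hasFreeSummand_iff] at h ⊢
  obtain ⟨i, π, h⟩ := h
  exact ⟨e.toLinearMap.comp i, π.comp e.symm.toLinearMap, fun x => by simp [h]⟩

theorem hasFreeSummand_congr {c : ℕ} (e : M ≃ₗ[A] M') :
    HasFreeSummand A M c ↔ HasFreeSummand A M' c :=
  ⟨fun h => h.congr e, fun h => h.congr e.symm⟩

variable {T : Type} {N : T → Type u} [∀ t, AddCommGroup (N t)] [∀ t, Module A (N t)]

theorem hasFreeSummand_card (I : Finset T) (hI : ∀ t ∈ I, Nonempty (N t ≃ₗ[A] A)) :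
    HasFreeSummand A (∀ t, N t) I.card := by
  classical
  rw [hasFreeSummand_iff]
  let σ : Fin I.card ≃ I := I.equivFin.symm
  let ε : ∀ t : I, N t ≃ₗ[A] A := fun t => (hI t t.2).some
  refine ⟨LinearMap.pi fun t => if h : t ∈ I then
      (ε ⟨t, h⟩).symm.toLinearMap.comp (LinearMap.proj (σ.symm ⟨t, h⟩)) else 0,
    LinearMap.pi fun s => (ε (σ s)).toLinearMap.comp (LinearMap.proj (σ s : T)), fun x => ?_⟩
  funext s
  simp

/-- A direct sum of free modules of rank one and of modules without maps onto `A / m` that lift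
to `A` has no free summand of larger rank than the number of free modules of rank one. -/
theorem HasFreeSummand.le_card [Fintype T] {m : Ideal A} [m.IsMaximal] (I : Finset T)
    (hI : ∀ t ∈ I, Nonempty (N t ≃ₗ[A] A))
    (hI' : ∀ t ∉ I, ∀ (f : N t →ₗ[A] A) (x : N t), f x ∈ m) {c : ℕ}
    (h : HasFreeSummand A (∀ t, N t) c) : c ≤ I.card := by
  classical
  obtain ⟨i, π, h⟩ := hasFreeSummand_iff.1 h
  let _ : Field (A ⧸ m) := Ideal.Quotient.field m
  let ε : ∀ t : I, N t ≃ₗ[A] A := fun t => (hI t t.2).some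
  let X : Matrix (Fin c) I (A ⧸ m) := fun r t =>
    Ideal.Quotient.mk m (π (Pi.single (t : T) ((ε t).symm 1)) r)
  let Y : Matrix I (Fin c) (A ⧸ m) := fun t s =>
    Ideal.Quotient.mk m (ε t (i (Pi.single s 1) t))
  have hXY : X * Y = 1 := by
    ext r s
    have h1 : ∑ t : T, π (Pi.single t (i (Pi.single s 1) t)) r =
        (1 : Matrix (Fin c) (Fin c) A) r s := by
      rw [← Finset.sum_apply, ← map_sum, Finset.univ_sum_single, h, Matrix.one_apply,
        Pi.single_apply]
    have h2 := congrArg (Ideal.Quotient.mk m) h1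
    rw [map_sum, ← Finset.sum_subset (Finset.subset_univ I), ← Finset.sum_coe_sort] at h2
    · rw [Matrix.mul_apply]
      convert h2 using 1
      · refine Finset.sum_congr rfl fun t _ => ?_
        change Ideal.Quotient.mk m _ * Ideal.Quotient.mk m _ = _
        rw [← map_mul]
        have h3 : i (Pi.single s 1) (t : T) = ε t (i (Pi.single s 1) t) • (ε t).symm 1 := by
          rw [← map_smul, smul_eq_mul, mul_one, LinearEquiv.symm_apply_apply]
        conv_rhs => rw [h3, Pi.single_smul, map_smul, Pi.smul_apply, smul_eq_mul, mul_comm]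
      · rw [Matrix.one_apply, Matrix.one_apply]
        split_ifs <;> simp
    · intro t _ ht
      refine Ideal.Quotient.eq_zero_iff_mem.2 ?_
      exact hI' t ht ((LinearMap.proj r).comp (π.comp (LinearMap.single A N t))) _
  have := (Matrix.rank_mul_le_left X Y).trans (Matrix.rank_le_card_width X)
  rw [hXY, Matrix.rank_one, Fintype.card_fin, Fintype.card_coe] at this
  exact this

end FreeSummand

/-! ### Iterated syzygies -/

section Betti

variable {A : Type u} [CommRing A]

theorem betti_congr (m : Ideal A) (i : ℕ) {M M' : Type u} [AddCommGroup M] [Module A M]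
    [AddCommGroup M'] [Module A M'] (e : M ≃ₗ[A] M') : betti A m i M = betti A m i M' :=
  (((Tor' (ModuleCat.{u} A) i).mapIso e.toModuleIso).app
    (ModuleCat.of A (A ⧸ m))).toLinearEquiv.length_eq

/-- The index sets of the direct sum decompositions of the iterated syzygies of a direct sum of
modules, the `j`-th of which has the direct sum of `j` copies of the `l`-th one as its syzygy. -/
def syzygyIndex (l : ℕ) (T : Type) (J : T → ℕ) : ℕ → Σ σ : Type, σ → ℕ
  | 0 => ⟨T, J⟩
  | n + 1 => ⟨Σ s : (syzygyIndex l T J n).1, Fin ((syzygyIndex l T J n).2 s), fun _ => l⟩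

instance syzygyIndex_fintype (l : ℕ) (T : Type) [Fintype T] (J : T → ℕ) :
    ∀ n, Fintype (syzygyIndex l T J n).1
  | 0 => inferInstanceAs (Fintype T)
  | n + 1 =>
    have := syzygyIndex_fintype l T J n
    inferInstanceAs (Fintype (Σ s : (syzygyIndex l T J n).1, Fin ((syzygyIndex l T J n).2 s)))

theorem card_syzygyIndex_succ (l : ℕ) (T : Type) [Fintype T] (J : T → ℕ) (n : ℕ) :
    Fintype.card (syzygyIndex l T J (n + 1)).1 = (∑ t, J t) * l ^ n := by
  have key : ∀ n, Fintype.card (syzygyIndex l T J (n + 1)).1 =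
      ∑ s : (syzygyIndex l T J n).1, (syzygyIndex l T J n).2 s := fun n => by
    refine (Fintype.card_sigma (α := fun s => Fin ((syzygyIndex l T J n).2 s))).trans ?_
    simp
  induction n with
  | zero => rw [key, pow_zero, mul_one]; rfl
  | succ n ih =>
    rw [key]
    change ∑ s : (syzygyIndex l T J (n + 1)).1, l = _
    rw [Finset.sum_const, Finset.card_univ, ih, smul_eq_mul, pow_succ, mul_assoc]

theorem betti_pi {m : Ideal A} [m.IsMaximal] (N : ℕ → Type u) [∀ j, AddCommGroup (N j)]
    [∀ j, Module A (N j)] (l : ℕ)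
    (h : ∀ j ≤ l, IsMinimalSyzygy m (Fin (j + 1)) (Fin j → N l) (N j)) {T : Type} [Fintype T]
    (J : T → ℕ) (hJ : ∀ t, J t ≤ l) (i : ℕ) :
    betti A m (i + 1) (∀ t, N (J t)) = ((∑ t, J t) * l ^ i * (l + 1) : ℕ) := by
  have hle : ∀ n s, (syzygyIndex l T J n).2 s ≤ l
    | 0 => hJ
    | n + 1 => fun _ => le_rfl
  have := betti_eq_card (m := m) (fun n => Σ s, Fin ((syzygyIndex l T J n).2 s + 1))
    (fun n => ∀ s : (syzygyIndex l T J n).1, N ((syzygyIndex l T J n).2 s))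
    (fun n => (IsMinimalSyzygy.pi fun s => h _ (hle n s)).congr
      (LinearEquiv.piCurry A fun _ _ => N l) (LinearEquiv.refl A _)) (i + 1)
  refine this.trans (congrArg _ ?_)
  rw [Fintype.card_sigma, ← card_syzygyIndex_succ l T J i]
  change ∑ s : (syzygyIndex l T J (i + 1)).1, Fintype.card (Fin (l + 1)) = _
  rw [Finset.sum_const, Finset.card_univ, smul_eq_mul, Fintype.card_fin]

end Betti

/-! ### Counting the summands -/

section Counting

theorem abs_card_filter_dvd_sub_le {δ : ℕ} (hδ : 1 ≤ δ) (q c : ℕ) :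
    |((Finset.univ.filter fun b : Fin q => δ ∣ c + b).card : ℝ) - q / δ| ≤ 1 := by
  have hpos : (0 : ℝ) < δ := by exact_mod_cast hδ
  have h1 : (Finset.univ.filter fun b : Fin q => δ ∣ c + b).card =
      q.count (· ≡ δ - c % δ [MOD δ]) := by
    have hc : c + (δ - c % δ) ≡ 0 [MOD δ] := by
      have h1 := Nat.mod_lt c hδ
      have h2 := Nat.div_add_mod c δ
      refine (Nat.modEq_zero_iff_dvd).2 ⟨c / δ + 1, ?_⟩
      rw [mul_add]
      omega
    have hiff : ∀ b : ℕ, δ ∣ c + b ↔ b ≡ δ - c % δ [MOD δ] := fun b => by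
      rw [← Nat.modEq_zero_iff_dvd]
      exact ⟨fun h => Nat.ModEq.add_left_cancel' c (h.trans hc.symm),
        fun h => (h.add_left c).trans hc⟩
    rw [Nat.count_eq_card_filter_range]
    refine Finset.card_bij (fun b _ => (b : ℕ)) (fun b hb => ?_) (fun a _ b _ h => Fin.ext h)
      fun b hb => ?_
    · simpa [← hiff] using hb
    · rw [Finset.mem_filter, Finset.mem_range] at hb
      exact ⟨⟨b, hb.1⟩, by simpa [hiff] using hb.2, rfl⟩
  rw [h1, Nat.count_modEq_card q hδ]
  have h2 : (q : ℝ) = δ * (q / δ : ℕ) + (q % δ : ℕ) := by exact_mod_cast (Nat.div_add_mod q δ).symm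
  have h3 : ((q % δ : ℕ) : ℝ) < δ := by exact_mod_cast Nat.mod_lt q hδ
  have h4 : (q : ℝ) / δ = (q / δ : ℕ) + (q % δ : ℕ) / δ := by
    conv_lhs => rw [h2, add_div, mul_div_cancel_left₀ _ hpos.ne']
  have h5 : ((q % δ : ℕ) : ℝ) / δ < 1 := (div_lt_one hpos).2 h3
  have h6 : (0 : ℝ) ≤ ((q % δ : ℕ) : ℝ) / δ := by positivity
  rw [h4, abs_le]
  split_ifs <;> push_cast <;> constructor <;> linarith

theorem tendsto_sum_frobIndex (p : ℕ) [Fact p.Prime] {δ : ℕ} (hδ : 1 ≤ δ) (h : ℕ → ℝ) :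
    Tendsto (fun e : ℕ => (∑ t : FrobIndex (p ^ e) δ, h t.1.2.2) / (p : ℝ) ^ (2 * e)) atTop
      (𝓝 ((∑ j : Fin δ, h j) / δ)) := by
  have hsum : ∀ q : ℕ, ∑ t : FrobIndex q δ, h t.1.2.2 = ∑ j : Fin δ, h j * ∑ a : Fin q,
      ((Finset.univ.filter fun b : Fin q => δ ∣ (q * j + a) + b).card : ℝ) := by
    intro q
    rw [← Finset.sum_subtype (Finset.univ.filter fun t : Fin q × Fin q × Fin δ =>
      δ ∣ q * t.2.2 + (t.1 + t.2.1)) (by simp) (fun t => h t.2.2), Finset.sum_filter,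
      Fintype.sum_prod_type]
    simp only [Fintype.sum_prod_type, Finset.card_filter, Nat.cast_sum, Finset.mul_sum]
    rw [Finset.sum_comm]
    simp only [add_assoc]
    rw [Finset.sum_comm (s := (Finset.univ : Finset (Fin δ)))]
    rw [Finset.sum_comm]
    refine Finset.sum_congr rfl fun a _ => ?_
    rw [Finset.sum_comm]
    refine Finset.sum_congr rfl fun j _ => Finset.sum_congr rfl fun b _ => ?_
    split_ifs <;> simp
  have hN : ∀ j : Fin δ, Tendsto (fun e : ℕ => (∑ a : Fin (p ^ e),
      ((Finset.univ.filter fun b : Fin (p ^ e) => δ ∣ (p ^ e * j + a) + b).card : ℝ)) /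
        (p : ℝ) ^ (2 * e)) atTop (𝓝 (1 / δ)) := by
    intro j
    have hp : 1 < (p : ℝ) := by exact_mod_cast (Fact.out : p.Prime).one_lt
    have hz : Tendsto (fun e : ℕ => ((p : ℝ) ^ e)⁻¹) atTop (𝓝 0) :=
      tendsto_inv_atTop_zero.comp (tendsto_pow_atTop_atTop_of_one_lt hp)
    refine tendsto_iff_dist_tendsto_zero.2
      (squeeze_zero (fun _ => dist_nonneg) (fun e => ?_) hz)
    have hq : (0 : ℝ) < (p : ℝ) ^ e := by positivity
    have h1 : |∑ a : Fin (p ^ e), (((Finset.univ.filter fun b : Fin (p ^ e) =>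
        δ ∣ (p ^ e * j + a) + b).card : ℝ) - (p ^ e : ℕ) / δ)| ≤ (p : ℝ) ^ e := by
      refine (Finset.abs_sum_le_sum_abs _ _).trans ?_
      refine (Finset.sum_le_sum fun a _ => abs_card_filter_dvd_sub_le hδ (p ^ e) _).trans ?_
      simp
    rw [Finset.sum_sub_distrib, Finset.sum_const, Finset.card_univ, Fintype.card_fin,
      nsmul_eq_mul] at h1
    rw [Real.dist_eq, pow_mul', sq]
    push_cast at h1
    have h2 : ∀ x : ℝ, x / ((p : ℝ) ^ e * (p : ℝ) ^ e) - 1 / δ =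
        (x - (p : ℝ) ^ e * ((p : ℝ) ^ e / δ)) / ((p : ℝ) ^ e * (p : ℝ) ^ e) := by
      intro x
      field_simp
    rw [h2, abs_div, abs_of_pos (mul_pos hq hq), div_le_iff₀ (mul_pos hq hq), ← mul_assoc,
      inv_mul_cancel₀ hq.ne', one_mul]
    exact h1
  have hlim := tendsto_finsetSum Finset.univ fun j _ => (hN j).const_mul (h j)
  refine (hlim.congr fun e => ?_).trans_eq ?_
  · rw [hsum, Finset.sum_div]
    exact Finset.sum_congr rfl fun j _ => (mul_div_assoc _ _ _).symm
  · rw [Finset.sum_div]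
    exact congrArg 𝓝 (Finset.sum_congr rfl fun j _ => mul_one_div _ _)

end Counting

/-! ### The residue field -/

section Residue

variable {k : Type u} [Field k] {δ : ℕ} (W : Submonoid (ratNormalCurve k δ))
  (hW : W ≤ (homMaxIdeal k δ).primeCompl) {A : Type u} [CommRing A] [Algebra (ratNormalCurve k δ) A]
  [IsLocalization W A] (n : Ideal A) [n.IsMaximal]
  (hn : n = (homMaxIdeal k δ).map (algebraMap (ratNormalCurve k δ) A))

theorem sub_algebraMap_constantCoeff_mem (r : ratNormalCurve k δ) :
    r - algebraMap k (ratNormalCurve k δ)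
      (MvPolynomial.constantCoeff (r : MvPolynomial (Fin 2) k)) ∈ homMaxIdeal k δ := by
  rw [mem_homMaxIdeal_iff]
  change MvPolynomial.constantCoeff (_ - MvPolynomial.C _) = 0
  rw [map_sub, MvPolynomial.constantCoeff_C, sub_self]

include hW hn in
theorem exists_quotient_mk_eq_algebraMap (x : A ⧸ n) :
    ∃ c : k, x = Ideal.Quotient.mk n (algebraMap _ A (algebraMap k (ratNormalCurve k δ) c)) := by
  let φ : k →+* A ⧸ n := (Ideal.Quotient.mk n).comp
    ((algebraMap _ A).comp (algebraMap k (ratNormalCurve k δ)))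
  have hφ : ∀ r : ratNormalCurve k δ, Ideal.Quotient.mk n (algebraMap _ A r) =
      φ (MvPolynomial.constantCoeff (r : MvPolynomial (Fin 2) k)) := by
    intro r
    refine Ideal.Quotient.eq.2 ?_
    rw [RingHom.comp_apply, ← map_sub, hn]
    exact Ideal.mem_map_of_mem _ (sub_algebraMap_constantCoeff_mem r)
  obtain ⟨a, rfl⟩ := Ideal.Quotient.mk_surjective x
  obtain ⟨⟨r, s⟩, h⟩ := IsLocalization.surj W a
  have hs : MvPolynomial.constantCoeff ((s : ratNormalCurve k δ) : MvPolynomial (Fin 2) k) ≠ 0 :=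
    hW s.2
  have h' := congrArg (Ideal.Quotient.mk n) h
  rw [map_mul, hφ, hφ] at h'
  refine ⟨MvPolynomial.constantCoeff (r : MvPolynomial (Fin 2) k) /
    MvPolynomial.constantCoeff ((s : ratNormalCurve k δ) : MvPolynomial (Fin 2) k), ?_⟩
  change _ = φ _
  let _ : Field (A ⧸ n) := Ideal.Quotient.field n
  rw [map_div₀, eq_div_iff ((map_ne_zero φ).2 hs)]
  exact h'

include hW hn in
theorem pow_surjective_quotient [IsAlgClosed k] {q : ℕ} (hq : 0 < q) :
    Function.Surjective fun x : A ⧸ n => x ^ q := by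
  intro x
  obtain ⟨c, rfl⟩ := exists_quotient_mk_eq_algebraMap W hW n hn x
  obtain ⟨c', rfl⟩ := IsAlgClosed.exists_pow_nat_eq c hq
  exact ⟨Ideal.Quotient.mk n (algebraMap _ A (algebraMap k (ratNormalCurve k δ) c')), by
    simp only [map_pow]⟩

end Residue

/-! ### Dimension -/

section Dimension

open MvPolynomial

theorem ringKrullDim_le_of_isIntegral (R S : Type*) [CommRing R] [CommRing S] [Algebra R S]
    [Algebra.IsIntegral R S] [FaithfulSMul R S] : ringKrullDim R ≤ ringKrullDim S := by
  refine iSup_le fun l => ?_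
  obtain ⟨Q, hQ, hQl⟩ := Ideal.nonempty_primesOver (S := S) l.head.asIdeal
  obtain ⟨L, hL, -⟩ := Ideal.exists_ltSeries_of_hasGoingUp l Q
  exact (congrArg _ hL).symm.trans_le (le_iSup (fun L : LTSeries (PrimeSpectrum S) =>
    (L.length : WithBot ℕ∞)) L)

variable (k : Type u) [Field k] {δ : ℕ} (hδ : 1 ≤ δ)

include hδ in
theorem isIntegral_ratNormalCurve :
    Algebra.IsIntegral (ratNormalCurve k δ) (MvPolynomial (Fin 2) k) := by
  constructor
  intro f
  have hX : ∀ i : Fin 2, IsIntegral (ratNormalCurve k δ) (X i : MvPolynomial (Fin 2) k) := by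
    intro i
    refine IsIntegral.of_pow hδ ?_
    have h := pow_mem_degreeMod (X_mem_degreeMod (k := k) (δ := δ) i) δ
    rw [degreeMod_congr (j := 0) (by simp [Nat.ModEq]), ← mem_ratNormalCurve_iff] at h
    exact isIntegral_algebraMap (R := ratNormalCurve k δ) (x := ⟨_, h⟩)
  induction f using MvPolynomial.induction_on with
  | C c => exact isIntegral_algebraMap (R := ratNormalCurve k δ) (x := algebraMap k _ c)
  | add f g hf hg => exact hf.add hg
  | mul_X f i hf => exact hf.mul (hX i)

include hδ in
theorem ringKrullDim_ratNormalCurve_le : ringKrullDim (ratNormalCurve k δ) ≤ 2 := by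
  have := isIntegral_ratNormalCurve k hδ
  refine (ringKrullDim_le_of_isIntegral (ratNormalCurve k δ) (MvPolynomial (Fin 2) k)).trans ?_
  rw [MvPolynomial.ringKrullDim_of_isNoetherianRing, ringKrullDim_eq_zero_of_field]
  simp

include hδ in
theorem two_le_height_homMaxIdeal : 2 ≤ (homMaxIdeal k δ).height := by
  let φ := algebraMap (ratNormalCurve k δ) (MvPolynomial (Fin 2) k)
  have hpow : ∀ i : Fin 2, (X i : MvPolynomial (Fin 2) k) ^ δ ∈ ratNormalCurve k δ := by
    intro i
    have h := pow_mem_degreeMod (X_mem_degreeMod (k := k) (δ := δ) i) δ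
    rwa [degreeMod_congr (j := 0) (by simp [Nat.ModEq]), ← mem_ratNormalCurve_iff] at h
  let P : Ideal (ratNormalCurve k δ) := (Ideal.span {(X 1 : MvPolynomial (Fin 2) k)}).comap φ
  have hP : P.IsPrime :=
    have := (Ideal.span_singleton_prime (X_ne_zero (R := k) (1 : Fin 2))).2 X_prime
    Ideal.comap_isPrime _ _
  have hmem : ∀ r : ratNormalCurve k δ, r ∈ P ↔ (X 1 : MvPolynomial (Fin 2) k) ∣ r :=
    fun r => Ideal.mem_span_singleton
  have h1 : (⊥ : Ideal (ratNormalCurve k δ)) < P := by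
    refine bot_lt_iff_ne_bot.2 fun h => ?_
    have : (⟨_, hpow 1⟩ : ratNormalCurve k δ) ∈ P := (hmem _).2 (dvd_pow_self _ (by omega))
    rw [h, Ideal.mem_bot, Subtype.ext_iff] at this
    exact pow_ne_zero δ (X_ne_zero (1 : Fin 2)) this
  have h2 : P < homMaxIdeal k δ := by
    refine lt_of_le_of_ne (fun r hr => ?_) fun h => ?_
    · obtain ⟨g, hg⟩ := (hmem r).1 hr
      rw [mem_homMaxIdeal_iff, hg]
      simp
    · have : (⟨_, hpow 0⟩ : ratNormalCurve k δ) ∈ P := by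
        rw [h, mem_homMaxIdeal_iff]
        simp [show δ ≠ 0 by omega]
      exact X_not_dvd_X_pow (by simp) δ ((hmem _).1 this)
  have : (⊥ : Ideal (ratNormalCurve k δ)).IsPrime := Ideal.isPrime_bot
  have := (homMaxIdeal_isMaximal k δ).isPrime
  have h3 := Ideal.height_add_one_le_of_lt_of_isPrime h1
  have h4 := Ideal.height_add_one_le_of_lt_of_isPrime h2
  calc (2 : ℕ∞) = 0 + 1 + 1 := by norm_num
    _ ≤ (⊥ : Ideal (ratNormalCurve k δ)).height + 1 + 1 := by gcongr; exact zero_le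
    _ ≤ P.height + 1 := by gcongr
    _ ≤ _ := h4

include hδ in
/-- Localizing the rational normal curve away from the complement of its vertex preserves the
dimension. -/
theorem ringKrullDim_eq_two (W : Submonoid (ratNormalCurve k δ)) (A : Type u) [CommRing A]
    [Algebra (ratNormalCurve k δ) A] [IsLocalization W A] (n : Ideal A) [n.IsMaximal]
    (hn : n = (homMaxIdeal k δ).map (algebraMap (ratNormalCurve k δ) A)) :
    ringKrullDim A = (2 : ℕ) := by
  apply le_antisymm
  · rw [ringKrullDim_le_iff_height_le]
    intro J hJ
    rw [← IsLocalization.height_under W]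
    exact (Ideal.height_le_ringKrullDim_of_ne_top (Ideal.IsPrime.ne_top inferInstance)).trans
      (ringKrullDim_ratNormalCurve_le k hδ)
  · have h1 : (homMaxIdeal k δ) = n.under (ratNormalCurve k δ) :=
      Ideal.IsMaximal.eq_of_le inferInstance (Ideal.IsPrime.ne_top inferInstance)
        (hn ▸ Ideal.le_comap_map)
    have h2 := two_le_height_homMaxIdeal k hδ
    rw [h1, IsLocalization.height_under W] at h2
    exact (WithBot.coe_le_coe.2 h2).trans
      (Ideal.height_le_ringKrullDim_of_ne_top (Ideal.IsMaximal.ne_top ‹n.IsMaximal›))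

end Dimension

/-! ### The invariants of localizations of the rational normal curve -/

section Main

open MvPolynomial

variable {k : Type u} [Field k] {δ : ℕ} (W : Submonoid (ratNormalCurve k δ))
  (hW : W ≤ (homMaxIdeal k δ).primeCompl) {A : Type u} [CommRing A]
  [Algebra (ratNormalCurve k δ) A] [IsLocalization W A] (n : Ideal A)
  (hn : n = (homMaxIdeal k δ).map (algebraMap (ratNormalCurve k δ) A))

theorem mem_homMaxIdeal_of_X_dvd {i : Fin 2} {r : ratNormalCurve k δ}
    (h : (X i : MvPolynomial (Fin 2) k) ∣ r) : r ∈ homMaxIdeal k δ := by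
  obtain ⟨g, hg⟩ := h
  rw [mem_homMaxIdeal_iff, hg]
  simp

include hW hn in
theorem apply_mem_of_X_dvd {j : ℕ} (hj : j ≤ δ)
    (f : covariants k δ j →ₗ[ratNormalCurve k δ] A) {i i' : Fin 2} (hi : i ≠ i')
    (u : covariants k δ j) (hu : (X i : MvPolynomial (Fin 2) k) ∣ u) : f u ∈ n := by
  have hprod : ∀ w : covariants k δ j, X 0 ^ (δ - j) * (w : MvPolynomial (Fin 2) k) ∈
      ratNormalCurve k δ := by
    intro w
    have := mul_mem_degreeMod (pow_mem_degreeMod (X_mem_degreeMod (k := k) (δ := δ) 0) (δ - j)) w.2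
    rw [degreeMod_congr (j := 0)
      (by rw [mul_one, Nat.sub_add_cancel hj]; simp [Nat.ModEq])] at this
    exact mem_ratNormalCurve_iff.2 this
  let v : covariants k δ j := ⟨X i' ^ j, by
    have := pow_mem_degreeMod (X_mem_degreeMod (k := k) (δ := δ) i') j
    rwa [mul_one] at this⟩
  have hsymm : (⟨_, hprod u⟩ : ratNormalCurve k δ) • v = (⟨_, hprod v⟩ : ratNormalCurve k δ) • u :=
    Subtype.ext (by
      rw [Submodule.coe_smul, Submodule.coe_smul, Subalgebra.smul_def, Subalgebra.smul_def,
        smul_eq_mul, smul_eq_mul]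
      ring)
  have h1 := congrArg f hsymm
  rw [map_smul, map_smul, Algebra.smul_def, Algebra.smul_def] at h1
  obtain ⟨⟨r, s⟩, hr⟩ := IsLocalization.surj W (f u)
  obtain ⟨⟨r', s'⟩, hr'⟩ := IsLocalization.surj W (f v)
  have hinj : Function.Injective (algebraMap (ratNormalCurve k δ) A) := by
    refine IsLocalization.injective A (M := W) fun w hw => mem_nonZeroDivisors_of_ne_zero ?_
    rintro rfl
    exact hW hw (zero_mem _)
  have h2 : (⟨_, hprod u⟩ : ratNormalCurve k δ) * r' * s = ⟨_, hprod v⟩ * r * s' := by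
    apply hinj
    simp only [map_mul]
    dsimp only at hr hr'
    rw [← hr, ← hr']
    linear_combination (algebraMap _ A (s : ratNormalCurve k δ)) *
      (algebraMap _ A (s' : ratNormalCurve k δ)) * h1
  have h3 : X 0 ^ (δ - j) * ((u : MvPolynomial (Fin 2) k) *
      (r' : MvPolynomial (Fin 2) k) * ((s : ratNormalCurve k δ) : MvPolynomial (Fin 2) k)) =
      X 0 ^ (δ - j) *
        (X i' ^ j * (r : MvPolynomial (Fin 2) k) *
          ((s' : ratNormalCurve k δ) : MvPolynomial (Fin 2) k)) := by
    have := congrArg (Subtype.val) h2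
    change X 0 ^ (δ - j) * (u : MvPolynomial (Fin 2) k) * (r' : MvPolynomial (Fin 2) k) *
      ((s : ratNormalCurve k δ) : MvPolynomial (Fin 2) k) =
      X 0 ^ (δ - j) * X i' ^ j * (r : MvPolynomial (Fin 2) k) *
          ((s' : ratNormalCurve k δ) : MvPolynomial (Fin 2) k) at this
    linear_combination this
  have h4 := mul_left_cancel₀ (pow_ne_zero _ (X_ne_zero 0)) h3
  have h5 : (X i : MvPolynomial (Fin 2) k) ∣
      X i' ^ j * (r : MvPolynomial (Fin 2) k) *
          ((s' : ratNormalCurve k δ) : MvPolynomial (Fin 2) k) :=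
    h4 ▸ Dvd.dvd.mul_right (Dvd.dvd.mul_right hu _) _
  have h6 : (X i : MvPolynomial (Fin 2) k) ∣ r := by
    rcases X_prime.dvd_or_dvd h5 with h | h
    · exact (X_prime.dvd_or_dvd h).resolve_left (X_not_dvd_X_pow hi j)
    · exact absurd (mem_homMaxIdeal_of_X_dvd h) (hW s'.2)
  have h7 : f u * algebraMap _ A (s : ratNormalCurve k δ) ∈ n := by
    rw [hr, hn]
    exact Ideal.mem_map_of_mem _ (mem_homMaxIdeal_of_X_dvd h6)
  rwa [Ideal.mul_unit_mem_iff_mem n (IsLocalization.map_units A s)] at h7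

end Main


section Abstract

theorem sum_fin_cast (δ : ℕ) : ∑ j : Fin δ, ((j : ℕ) : ℝ) = δ * (δ - 1) / 2 := by
  rw [Fin.sum_univ_eq_sum_range (fun j => (j : ℝ))]
  induction δ with
  | zero => simp
  | succ n ih =>
    rw [Finset.sum_range_succ, ih]
    push_cast
    ring

variable (p : ℕ) [Fact p.Prime] (A : Type u) [CommRing A] [CharP A p] (n : Ideal A)

/-- A family of modules with the formal properties of the modules of covariants over the rational
normal curve of degree `δ`. -/
structure IsCovariantFamily (δ : ℕ) (N : ℕ → Type u) [∀ j, AddCommGroup (N j)]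
    [∀ j, Module A (N j)] : Prop where
  dim : ringKrullDim A = (2 : ℕ)
  perfect : ∀ q : ℕ, 0 < q → Function.Surjective fun x : A ⧸ n => x ^ q
  syzygy : ∀ j < δ, IsMinimalSyzygy n (Fin (j + 1)) (Fin j → N (δ - 1)) (N j)
  frobPush : ∀ e, Nonempty ((∀ t : FrobIndex (p ^ e) δ, N t.1.2.2) ≃ₗ[A] FrobPush A p e)
  free : Nonempty (N 0 ≃ₗ[A] A)
  not_free : ∀ j < δ, j ≠ 0 → ∀ (f : N j →ₗ[A] A) (x : N j), f x ∈ n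

variable {p A n} {δ : ℕ} {N : ℕ → Type u} [∀ j, AddCommGroup (N j)] [∀ j, Module A (N j)]

namespace IsCovariantFamily

variable (h : IsCovariantFamily p A n δ N) (hδ : 1 ≤ δ)

include h in
/-- The minimal cover of the Frobenius pushforward. -/
theorem exists_isMinimalSyzygy_frobPush (e : ℕ) :
    ∃ (K : Type u) (_ : AddCommGroup K) (_ : Module A K),
      IsMinimalSyzygy n (Σ t : FrobIndex (p ^ e) δ, Fin (t.1.2.2 + 1)) K (FrobPush A p e) := by
  obtain ⟨ε⟩ := h.frobPush e
  exact ⟨_, _, _, (IsMinimalSyzygy.pi fun t : FrobIndex (p ^ e) δ =>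
    h.syzygy t.1.2.2 t.1.2.2.2).congr (LinearEquiv.refl A _) ε⟩

include h in
theorem frobenius_finite : (frobenius A p).Finite := by
  obtain ⟨K, _, _, hK⟩ := h.exists_isMinimalSyzygy_frobPush 1
  have hfin : (iterateFrobenius A p 1).Finite := hK.finite
  rwa [iterateFrobenius_one] at hfin

variable [n.IsMaximal]

include h in
theorem residueDegree_eq_one : residueDegree p A n = 1 := by
  let _ : Field (A ⧸ n) := Ideal.Quotient.field n
  have : CharP (A ⧸ n) p := charP_quotient A p n
  change Module.finrank (frobenius (A ⧸ n) p).fieldRange (A ⧸ n) = 1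
  refine finrank_eq_one 1 one_ne_zero fun w => ?_
  obtain ⟨v, hv⟩ := h.perfect p (Fact.out : p.Prime).pos w
  exact ⟨⟨w, v, hv⟩, mul_one w⟩

include h hδ in
theorem hasHilbertKunzMultiplicity : HasHilbertKunzMultiplicity p A n ((δ + 1) / 2) := by
  refine ⟨2, fun e => ∑ t : FrobIndex (p ^ e) δ, (t.1.2.2 + 1), h.dim, fun e => ?_, ?_⟩
  · obtain ⟨K, _, _, hK⟩ := h.exists_isMinimalSyzygy_frobPush e
    have h1 := hK.length_quotient
    rw [length_quotient_frobPower p e n (h.perfect _ (pow_pos (Fact.out : p.Prime).pos e))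
      (by rw [h1]; exact ENat.natCast_ne_top _), h1, Fintype.card_sigma]
    simp
  · have hlim := tendsto_sum_frobIndex p hδ fun j => (j : ℝ) + 1
    have hδ' : (δ : ℝ) ≠ 0 := by exact_mod_cast (by omega : δ ≠ 0)
    have hsum : (∑ j : Fin δ, ((j : ℕ) + 1 : ℝ)) / δ = (δ + 1) / 2 := by
      rw [Finset.sum_add_distrib, sum_fin_cast]
      simp
      field_simp
      ring
    rw [hsum] at hlim
    refine hlim.congr fun e => ?_
    push_cast
    rfl

include h hδ in
theorem hasFSignature : HasFSignature p A n (1 / δ) := by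
  classical
  refine ⟨h.frobenius_finite, 2,
    fun e => (Finset.univ.filter fun t : FrobIndex (p ^ e) δ => (t.1.2.2 : ℕ) = 0).card,
    h.dim, fun e => ?_, ?_⟩
  · obtain ⟨ε⟩ := h.frobPush e
    have hI : ∀ t ∈ (Finset.univ.filter fun t : FrobIndex (p ^ e) δ => (t.1.2.2 : ℕ) = 0),
        Nonempty (N t.1.2.2 ≃ₗ[A] A) := by
      intro t ht
      rw [(Finset.mem_filter.1 ht).2]
      exact h.free
    constructor
    · exact (hasFreeSummand_card _ hI).congr ε
    · intro c hc
      exact HasFreeSummand.le_card (m := n) _ hI (fun t ht f x => h.not_free _ t.1.2.2.2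
        (fun h0 => ht (Finset.mem_filter.2 ⟨Finset.mem_univ _, h0⟩)) f x)
        ((hasFreeSummand_congr ε).2 hc)
  · have hlim := tendsto_sum_frobIndex p hδ fun j => if j = 0 then 1 else 0
    have hsum : ∑ j : Fin δ, (if (j : ℕ) = 0 then 1 else 0 : ℝ) = 1 := by
      rw [Finset.sum_eq_single ⟨0, hδ⟩]
      · simp
      · intro j _ hj
        exact if_neg fun h0 => hj (Fin.ext h0)
      · exact fun h0 => absurd (Finset.mem_univ _) h0
    rw [hsum] at hlim
    refine hlim.congr fun e => ?_
    rw [h.residueDegree_eq_one, Finset.sum_boole]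
    simp

include h hδ in
theorem hasFrobeniusBetti (i : ℕ) (hi : 1 ≤ i) :
    HasFrobeniusBetti p A n i (δ * (δ - 1) ^ i / 2) := by
  obtain ⟨i, rfl⟩ := Nat.exists_eq_add_of_le' hi
  refine ⟨h.frobenius_finite, 2,
    fun e => (∑ t : FrobIndex (p ^ e) δ, (t.1.2.2 : ℕ)) * (δ - 1) ^ i * (δ - 1 + 1),
    h.dim, fun e => ?_, ?_⟩
  · obtain ⟨ε⟩ := h.frobPush e
    rw [← betti_congr n _ ε]
    exact betti_pi N (δ - 1) (fun j hj => h.syzygy j (by omega))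
      (fun t : FrobIndex (p ^ e) δ => (t.1.2.2 : ℕ)) (fun t => Nat.le_sub_one_of_lt t.1.2.2.2) i
  · have hlim := (tendsto_sum_frobIndex p hδ fun j => (j : ℝ)).mul_const
      (((δ : ℝ) - 1) ^ i * δ)
    have hδ' : (δ : ℝ) ≠ 0 := by exact_mod_cast (by omega : δ ≠ 0)
    have hsum : (∑ j : Fin δ, ((j : ℕ) : ℝ)) / δ * (((δ : ℝ) - 1) ^ i * δ) =
        δ * (δ - 1) ^ (i + 1) / 2 := by
      rw [sum_fin_cast]
      field_simp
      ring
    rw [hsum] at hlim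
    refine hlim.congr fun e => ?_
    rw [h.residueDegree_eq_one, Nat.sub_add_cancel hδ]
    push_cast [Nat.cast_sub hδ]
    rw [one_pow, one_mul]
    ring

end IsCovariantFamily

end Abstract

section Main

variable {k : Type u} [Field k] {δ : ℕ} (W : Submonoid (ratNormalCurve k δ))
  (hW : W ≤ (homMaxIdeal k δ).primeCompl) {A : Type u} [CommRing A]
  [Algebra (ratNormalCurve k δ) A] [IsLocalization W A] (n : Ideal A)
  (hn : n = (homMaxIdeal k δ).map (algebraMap (ratNormalCurve k δ) A))

variable (k δ) in
/-- The type underlying the module of covariants. -/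
def Covariants (j : ℕ) : Type u := covariants k δ j

instance (j : ℕ) : AddCommGroup (Covariants k δ j) :=
  inferInstanceAs (AddCommGroup (covariants k δ j))

instance (j : ℕ) : Module (ratNormalCurve k δ) (Covariants k δ j) :=
  inferInstanceAs (Module (ratNormalCurve k δ) (covariants k δ j))

set_option synthInstance.maxHeartbeats 400000 in
theorem Covariants.isMinimalSyzygy (hδ : 1 ≤ δ) {j : ℕ} (hj : j < δ) :
    IsMinimalSyzygy (homMaxIdeal k δ) (Fin (j + 1)) (Fin j → Covariants k δ (δ - 1))
      (Covariants k δ j) :=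
  isMinimalSyzygy_covariants hδ hj

/-- The module of covariants of degree zero is the ring itself. -/
def covariantsZeroEquiv : Covariants k δ 0 ≃ₗ[ratNormalCurve k δ] ratNormalCurve k δ where
  toFun f := ⟨f.1, mem_ratNormalCurve_iff.2 f.2⟩
  invFun r := ⟨r, mem_ratNormalCurve_iff.1 r.2⟩
  left_inv _ := rfl
  right_inv _ := rfl
  map_add' _ _ := rfl
  map_smul' _ _ := rfl

set_option synthInstance.maxHeartbeats 400000 in
/-- The Frobenius pushforward of the rational normal curve is a direct sum of modules of
covariants. -/
def piCovariantsEquivFrobPush [IsAlgClosed k] (p : ℕ) [Fact p.Prime] [CharP k p] (e : ℕ)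
    (hδ : 1 ≤ δ) : (∀ t : FrobIndex (p ^ e) δ, Covariants k δ t.1.2.2) ≃ₗ[ratNormalCurve k δ]
      FrobPush (ratNormalCurve k δ) p e :=
  frobPushEquiv k p e δ hδ

include hW hn in
theorem Covariants.apply_mem_of_baseChange {j : ℕ} (h0 : j ≠ 0) (hj : j < δ)
    (f : BaseChange (ratNormalCurve k δ) A (Covariants k δ j) →ₗ[A] A)
    (x : BaseChange (ratNormalCurve k δ) A (Covariants k δ j)) : f x ∈ n := by
  have hspan : Submodule.span (ratNormalCurve k δ)
      (Set.range (covariantsGen (k := k) (δ := δ) j) : Set (Covariants k δ j)) = ⊤ :=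
    span_covariantsGen hj
  refine apply_mem_of_span_eq_top A n hspan (fun g u hu => ?_) f x
  obtain ⟨i, rfl⟩ := hu
  by_cases hi : (i : ℕ) = 0
  · refine apply_mem_of_X_dvd W hW n hn hj.le g (i := 0) (i' := 1) (by simp) _ ?_
    exact Dvd.dvd.mul_right (dvd_pow_self _ (by omega)) _
  · refine apply_mem_of_X_dvd W hW n hn hj.le g (i := 1) (i' := 0) (by simp) _ ?_
    exact Dvd.dvd.mul_left (dvd_pow_self _ hi) _

set_option synthInstance.maxHeartbeats 400000 in
include hW hn in
theorem isCovariantFamily_baseChange [IsAlgClosed k] (p : ℕ) [Fact p.Prime] [CharP k p] [CharP A p]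
    [n.IsMaximal] (hδ : 1 ≤ δ) :
    IsCovariantFamily p A n δ fun j => BaseChange (ratNormalCurve k δ) A (Covariants k δ j) where
  dim := ringKrullDim_eq_two k hδ W A n hn
  perfect q hq := pow_surjective_quotient W hW n hn hq
  syzygy j hj := by
    have : Module.Flat (ratNormalCurve k δ) A := IsLocalization.flat A W
    rw [hn]
    exact (Covariants.isMinimalSyzygy hδ hj).baseChange_pi A
  frobPush e := nonempty_pi_baseChange_equiv_frobPush A p W e (piCovariantsEquivFrobPush p e hδ)
  free := nonempty_baseChange_equiv A covariantsZeroEquiv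
  not_free j hj h0 f x := Covariants.apply_mem_of_baseChange W hW n hn h0 hj f x

end Main

end FrobeniusBetti
end

open FrobeniusBetti

theorem theorem4 {k : Type u} [Field k] [IsAlgClosed k] (p : ℕ) [Fact p.Prime] [CharP k p]
    (δ : ℕ) (hδ : 2 ≤ δ) :
    -- the graded ring `R = k[x^δ, x^(δ-1) y, …, y^δ]` with its homogeneous maximal ideal
    (HasFSignature p (ratNormalCurve k δ) (homMaxIdeal k δ) (1 / δ) ∧
      HasHilbertKunzMultiplicity p (ratNormalCurve k δ) (homMaxIdeal k δ) ((δ + 1) / 2) ∧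
      ∀ i : ℕ, 1 ≤ i →
        HasFrobeniusBetti p (ratNormalCurve k δ) (homMaxIdeal k δ) i (δ * (δ - 1) ^ i / 2)) ∧
    -- the local ring `R_m`
    (HasFSignature p (ratNormalCurveLocal k δ)
        (IsLocalRing.maximalIdeal (ratNormalCurveLocal k δ)) (1 / δ) ∧
      HasHilbertKunzMultiplicity p (ratNormalCurveLocal k δ)
        (IsLocalRing.maximalIdeal (ratNormalCurveLocal k δ)) ((δ + 1) / 2) ∧
      ∀ i : ℕ, 1 ≤ i →
        HasFrobeniusBetti p (ratNormalCurveLocal k δ)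
          (IsLocalRing.maximalIdeal (ratNormalCurveLocal k δ)) i (δ * (δ - 1) ^ i / 2)) := by
  have hδ' : 1 ≤ δ := by omega
  have : IsLocalization (⊥ : Submonoid (ratNormalCurve k δ)) (ratNormalCurve k δ) :=
    IsLocalization.self bot_le
  have hgr := isCovariantFamily_baseChange (⊥ : Submonoid (ratNormalCurve k δ)) bot_le
    (homMaxIdeal k δ) (Ideal.map_id _).symm p hδ'
  have hloc := isCovariantFamily_baseChange (A := ratNormalCurveLocal k δ)
    (homMaxIdeal k δ).primeCompl le_rfl (IsLocalRing.maximalIdeal (ratNormalCurveLocal k δ))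
    (Localization.AtPrime.map_eq_maximalIdeal (I := homMaxIdeal k δ)).symm p hδ'
  exact ⟨⟨hgr.hasFSignature hδ', hgr.hasHilbertKunzMultiplicity hδ', hgr.hasFrobeniusBetti hδ'⟩,
    hloc.hasFSignature hδ', hloc.hasHilbertKunzMultiplicity hδ', hloc.hasFrobeniusBetti hδ'⟩
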